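/- Let $0<a<b$ and $\lambda\ge 0$, let $D_r\subset\mathbb R^2$ be the closed disc of radius $r$ centred at the origin $O$, and let $\mathscr C_{a,b}$ be the class of convex sets $K$ with $D_a\subseteq K\subseteq D_b$. A set is called optimal if it belongs to $\mathscr C_{a,b}$ and minimizes $J_\lambda(K)=\lambda|K|-P(K)$ over $\mathscr C_{a,b}$, where $|K|$ is the area and $P(K)$ the perimeter (the length of the boundary) of $K$. Consider segments of three kinds: * tangent sides: unions $TQ\cup QT'$ of the two tangent segments from a point $Q$ with $a<|Q|<b$ to $\partial D_a$, where $T\ne T'$ are the points of tangency; such a union counts as one element, with central angle $\theta=\angle TOQ$; * chords $PP'$ of $D_b$ ($P\neq P'$, $|P|=|P'|=b$) whose midpoint $M$ satisfies $|M|>a$ (equivalently, which do not meet $D_a$); a chord counts as one element, with central angle $\eta=\angle POM$; * segments $TP$ with $|T|=a$ and $|P|=b$ that are tangent to $D_a$ at $T$. Let $\mathscr K_{a,b}$ be the class of sets $\Omega$ with $D_a\subseteq\Omega\subseteq D_b$ whose boundary is the union of a (possibly infinite) family of elements of these three kinds. For such $\Omega$, let $\mathscr A^a$ be the multiset of the central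 angles of all elements of the first kind contained in $\partial\Omega$, and $\mathscr A_b$ the multiset of the central angles of all elements of the second kind contained in $\partial\Omega$ (both counted with multiplicity, a priori possibly infinite). **Theorem.** Let $\Omega$ be an optimal set belonging to $\mathscr K_{a,b}$. Then: 1. if $\lambda\ne 2/a$, there exists $\theta\in(0,\pi/2)$ such that, if $\mathscr A^a$ is not empty, then $\mathscr A^a=\{\theta\}$ (a single element, of multiplicity one); 2. there exist $x,y\in(0,\pi/2)$ such that, if $\mathscr A_b$ is not empty, then for some integer $n\ge1$ either $\mathscr A_b$ consists of $n$ copies of $x$, or $\mathscr A_b$ consists of $n$ copies of $x$ and one copy of $y$, with $x>y$ and $\cos x+\cos y=\dfrac1{b\lambda}$. -/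

import Mathlib

/-! The plane is identified with `ℂ`, as a Euclidean plane with Lebesgue measure `volume`. -/

noncomputable section

namespace AnnulusProblem

open MeasureTheory Set

/-- `D_r`, the disc of radius `r` centred at the origin. -/
def disc (r : ℝ) : Set ℂ := Metric.closedBall 0 r

/-- The perimeter: the length (one-dimensional Hausdorff measure) of the boundary. -/
def perimeter (Ω : Set ℂ) : ℝ := (Measure.hausdorffMeasure 1 (frontier Ω)).toReal

/-- The functional `λ |Ω| - P(Ω)`. -/
def J (lam : ℝ) (Ω : Set ℂ) : ℝ := lam * (volume Ω).toReal - perimeter Ω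

/-- The class of convex sets `K` with `D_a ⊆ K ⊆ D_b`. -/
def classC (a b : ℝ) : Set (Set ℂ) := {K | Convex ℝ K ∧ disc a ⊆ K ∧ K ⊆ disc b}

/-- `Ω` is optimal: it minimizes `λ |Ω| - P(Ω)` over the convex sets between `D_a` and `D_b`. -/
def IsOptimal (a b lam : ℝ) (Ω : Set ℂ) : Prop :=
  Ω ∈ classC a b ∧ ∀ K ∈ classC a b, J lam Ω ≤ J lam K

/-- The line through `T` and `Q` touches the circle `∂D_a` at `T` (when `Q = T`, this only says
that `T` lies on the circle). -/
def TangentAt (a : ℝ) (T Q : ℂ) : Prop := ‖T‖ = a ∧ inner ℝ T (Q - T) = 0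

/-- `S` is a tangent side to `D_a` that is not a chord of `D_b`, with central angle `θ`: the two
tangent segments `TQ` and `QT'` from a point `Q` of the open annulus to `∂D_a`, identified as one
element. (As `T ≠ T'`, the point `Q` is outside `D_a`.) -/
def IsTangentSide (a b θ : ℝ) (S : Set ℂ) : Prop :=
  ∃ T Q T' : ℂ, T ≠ T' ∧ TangentAt a T Q ∧ TangentAt a T' Q ∧ ‖Q‖ < b ∧
    S = segment ℝ T Q ∪ segment ℝ Q T' ∧ InnerProductGeometry.angle T Q = θ

/-- `S` is a chord `PP'` of `D_b` that is not tangent to `D_a` (nor meets it), with central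
angle `η`: the angle at the origin of the half chord from `P` to the midpoint. The two half chords
are identified as one element. -/
def IsChord (a b η : ℝ) (S : Set ℂ) : Prop :=
  ∃ P P' : ℂ, P ≠ P' ∧ ‖P‖ = b ∧ ‖P'‖ = b ∧ a < ‖midpoint ℝ P P'‖ ∧
    S = segment ℝ P P' ∧ InnerProductGeometry.angle P (midpoint ℝ P P') = η

/-- `S` is a segment `TP` tangent to `D_a` at `T ∈ ∂D_a`, with `P ∈ ∂D_b`: half of a chord of `D_b`
tangent to `D_a`. -/
def IsTangentHalfChord (a b : ℝ) (S : Set ℂ) : Prop :=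
  ∃ T P : ℂ, TangentAt a T P ∧ ‖P‖ = b ∧ S = segment ℝ T P

/-- The class `𝒦_{a,b}`: sets between `D_a` and `D_b` whose boundary is a union (of a possibly
infinite family) of segments of the three kinds. -/
def classK (a b : ℝ) : Set (Set ℂ) :=
  {Ω | disc a ⊆ Ω ∧ Ω ⊆ disc b ∧ ∃ F : Set (Set ℂ),
    (∀ S ∈ F, (∃ θ, IsTangentSide a b θ S) ∨ (∃ η, IsChord a b η S) ∨ IsTangentHalfChord a b S) ∧
    frontier Ω = ⋃₀ F}

/-- `𝒜^a`, the possibly infinite multiset of the central angles of the sides of `Ω` tangent only to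
`D_a`, given by its multiplicity function. -/
def anglesA (a b : ℝ) (Ω : Set ℂ) : ℝ → ℕ∞ :=
  fun θ => {S | IsTangentSide a b θ S ∧ S ⊆ frontier Ω}.encard

/-- `𝒜_b`, the possibly infinite multiset of the central angles of the sides of `Ω` that are
chords of `D_b` not tangent to `D_a`, given by its multiplicity function. -/
def anglesB (a b : ℝ) (Ω : Set ℂ) : ℝ → ℕ∞ :=
  fun η => {S | IsChord a b η S ∧ S ⊆ frontier Ω}.encard

/-- The multiset consisting of `n` copies of `x`, given by its multiplicity function. -/
def copies (n : ℕ) (x : ℝ) : ℝ → ℕ∞ := Pi.single x (n : ℕ∞)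

end AnnulusProblem

end

noncomputable section

namespace AnnulusProblem

open MeasureTheory Set

/-! ### Polar points, half-planes, sectors -/

/-! Cut the plane into sectors at the origin. Since `frontier` is local, and since a ray meets the
boundary of a set of the class in a single point, `J` is a sum of sector contributions (`Jl_add`,
`J_eq_Jl`). An element of central angle η contributes `2 * F η`, where F is computed from a
triangle: `sideF` is a constant times tan η, and `chordF` is a combination of sin η cos η and sin η.

The main tool is `exchange`. Two distinct elements of the same kind, of angles x and y, can be
replaced by elements of angles x + t and y - t, if the part of the boundary between them is rotated
by 2t. All junctions lie on one circle, of radius a for sides and b for chords, whose tangents there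
are supporting lines; hence the pieces reassemble into a convex set (`exists_glue`). So for an
optimal set F(x + t) + F(y - t) ≥ F(x) + F(y) for all small t of either sign: the strict
inequalities in the definitions of the elements leave room for both.

For sides with λ < 2/a, the coefficient of tan is negative and tan is strictly convex, so widening
the larger of two angles would lower `J`: there is at most one side. With λ > 2/a the coefficient is
positive, and cutting a side by the tangent in its central direction (`split_side`) lowers `J`:
there is no side at all.

For chords, put s = (x + y)/2 and δ = (x - y)/2. With s fixed, F(x) + F(y) is a quadratic polynomial
in cos δ (`chordF_add`). Minimality gives λb(cos x + cos y) = 1 if x ≠ y, and 2λb cos x ≤ 1 if two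
chords share the angle x (`chord_pair`). By injectivity of cos there are at most two angles, and the
smaller cannot be repeated. Multiplicities are finite because chords of equal angle occupy disjoint
sectors (`finite_chords`).

An optimal set need not be closed; its closure has the same frontier and the same `J`, so everything
is proved for the closure. -/

/-- The point with polar coordinates `(r, ψ)`. -/
def pol (r ψ : ℝ) : ℂ := ⟨r * Real.cos ψ, r * Real.sin ψ⟩

/-- The half-plane `{z | Re (z e^{-iv}) ≤ d}`. -/
def hp (d v : ℝ) : Set ℂ := {z | z.re * Real.cos v + z.im * Real.sin v ≤ d}

/-- The open sector of nonzero points with argument in `(α, β)`. -/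
def sec (α β : ℝ) : Set ℂ := {z | z ≠ 0 ∧ z.arg ∈ Ioo α β}

@[simp] lemma pol_re (r ψ : ℝ) : (pol r ψ).re = r * Real.cos ψ := rfl

@[simp] lemma pol_im (r ψ : ℝ) : (pol r ψ).im = r * Real.sin ψ := rfl

lemma pol_zero (ψ : ℝ) : pol 0 ψ = 0 := by
  apply Complex.ext <;> simp

lemma pol_eq (r ψ : ℝ) :
    pol r ψ = (r : ℂ) * (Complex.cos (ψ : ℂ) + Complex.sin (ψ : ℂ) * Complex.I) := by
  apply Complex.ext <;>
    simp [Complex.cos_ofReal_re, Complex.sin_ofReal_re, Complex.cos_ofReal_im,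
      Complex.sin_ofReal_im]

lemma pol_eq_exp (r ψ : ℝ) : pol r ψ = (r : ℂ) * Complex.exp (ψ * Complex.I) := by
  rw [pol_eq, Complex.exp_mul_I]

lemma norm_pol (r ψ : ℝ) : ‖pol r ψ‖ = |r| := by
  rw [pol_eq_exp, norm_mul, Complex.norm_exp_ofReal_mul_I, mul_one, Complex.norm_real,
    Real.norm_eq_abs]

lemma smul_pol (s r ψ : ℝ) : s • pol r ψ = pol (s * r) ψ := by
  apply Complex.ext <;> simp [mul_assoc]

lemma pol_arg (z : ℂ) : pol ‖z‖ z.arg = z := by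
  rw [pol_eq_exp, Complex.norm_mul_exp_arg_mul_I]

lemma arg_pol {r ψ : ℝ} (hr : 0 < r) (hψ : ψ ∈ Ioc (-Real.pi) Real.pi) :
    (pol r ψ).arg = ψ := by
  rw [pol_eq, Complex.arg_mul_cos_add_sin_mul_I hr hψ]

lemma pol_add_two_pi (r ψ : ℝ) : pol r (ψ + 2 * Real.pi) = pol r ψ := by
  simp [pol]

lemma pol_add_int (r ψ : ℝ) (k : ℤ) : pol r (ψ + k * (2 * Real.pi)) = pol r ψ := by
  simp [pol, Real.cos_add_int_mul_two_pi, Real.sin_add_int_mul_two_pi]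

lemma mem_hp {d v : ℝ} {z : ℂ} :
    z ∈ hp d v ↔ z.re * Real.cos v + z.im * Real.sin v ≤ d := Iff.rfl

lemma pol_mem_hp {d v r ψ : ℝ} : pol r ψ ∈ hp d v ↔ r * Real.cos (ψ - v) ≤ d := by
  rw [mem_hp, Real.cos_sub, pol_re, pol_im]
  ring_nf

lemma convex_hp (d v : ℝ) : Convex ℝ (hp d v) := by
  intro z hz w hw s t hs ht hst
  simp only [mem_hp] at *
  simp only [Complex.add_re, Complex.add_im, Complex.real_smul, Complex.mul_re, Complex.mul_im,
    Complex.ofReal_re, Complex.ofReal_im, zero_mul, sub_zero, add_zero]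
  calc _ = s * (z.re * Real.cos v + z.im * Real.sin v)
        + t * (w.re * Real.cos v + w.im * Real.sin v) := by ring
    _ ≤ s * d + t * d := by gcongr
    _ = d := by rw [← add_mul, hst, one_mul]

lemma zero_mem_hp {d v : ℝ} (hd : 0 ≤ d) : (0 : ℂ) ∈ hp d v := by
  simpa [mem_hp] using hd

lemma hp_add_two_pi (d v : ℝ) : hp d (v + 2 * Real.pi) = hp d v := by
  ext; simp [mem_hp]

lemma disc_subset_hp {a d v : ℝ} (had : a ≤ d) : disc a ⊆ hp d v := by
  intro z hz
  rw [← pol_arg z, pol_mem_hp]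
  have hz : ‖z‖ ≤ a := by simpa [disc] using hz
  have := mul_le_mul_of_nonneg_left (Real.cos_le_one (z.arg - v)) (norm_nonneg z)
  linarith

lemma pol_mem_disc {a r ψ : ℝ} (hr : 0 ≤ r) : pol r ψ ∈ disc a ↔ r ≤ a := by
  simp [disc, norm_pol, abs_of_nonneg hr]

lemma pol_mem_sec {α β r ψ : ℝ} (hα : -Real.pi ≤ α) (hβ : β ≤ Real.pi) (hr : 0 < r)
    (hψ : ψ ∈ Ioo α β) : pol r ψ ∈ sec α β := by
  have h : ψ ∈ Ioc (-Real.pi) Real.pi := ⟨hα.trans_lt hψ.1, hψ.2.le.trans hβ⟩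
  refine ⟨?_, by rwa [arg_pol hr h]⟩
  rw [← norm_ne_zero_iff, norm_pol]
  exact (abs_pos.2 hr.ne').ne'

lemma exists_pol_of_mem_sec {α β : ℝ} {z : ℂ} (hz : z ∈ sec α β) :
    ∃ r ψ, 0 < r ∧ ψ ∈ Ioo α β ∧ z = pol r ψ :=
  ⟨‖z‖, z.arg, norm_pos_iff.2 hz.1, hz.2, (pol_arg z).symm⟩

lemma isOpen_sec {α β : ℝ} (hβ : β ≤ Real.pi) : IsOpen (sec α β) := by
  rw [isOpen_iff_mem_nhds]
  rintro z ⟨hz, hza⟩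
  have hs : z ∈ Complex.slitPlane :=
    Complex.mem_slitPlane_iff_arg.2 ⟨(hza.2.trans_le hβ).ne, hz⟩
  filter_upwards [(Complex.continuousAt_arg hs).eventually (Ioo_mem_nhds hza.1 hza.2),
    isOpen_ne.mem_nhds hz] with w hw hw'
  exact ⟨hw', hw⟩

lemma frontier_sec {α β : ℝ} (hα : -Real.pi ≤ α) (hβ : β ≤ Real.pi) {z : ℂ}
    (hz : z ∈ frontier (sec α β)) : z = pol ‖z‖ α ∨ z = pol ‖z‖ β := by
  have hcl : IsClosed {z : ℂ | ∃ ψ ∈ Icc α β, z = pol ‖z‖ ψ} := by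
    have : {z : ℂ | ∃ ψ ∈ Icc α β, z = pol ‖z‖ ψ} =
        Prod.fst '' {p : ℂ × Icc α β | p.1 = pol ‖p.1‖ p.2} := by
      ext z
      simp only [mem_image, Prod.exists, exists_and_right, exists_eq_right]
      constructor
      · rintro ⟨ψ, hψ, h⟩
        exact ⟨⟨ψ, hψ⟩, h⟩
      · rintro ⟨⟨ψ, hψ⟩, h⟩
        exact ⟨ψ, hψ, h⟩
    rw [this]
    apply isClosedMap_fst_of_compactSpace
    refine isClosed_eq continuous_fst ?_
    simp only [pol_eq_exp]
    fun_prop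
  have hsub : sec α β ⊆ {z : ℂ | ∃ ψ ∈ Icc α β, z = pol ‖z‖ ψ} := fun w hw =>
    ⟨w.arg, ⟨hw.2.1.le, hw.2.2.le⟩, (pol_arg w).symm⟩
  obtain ⟨ψ, hψ, h⟩ := closure_minimal hsub hcl hz.1
  have hns : z ∉ sec α β := by
    have := hz.2
    rwa [(isOpen_sec hβ).interior_eq] at this
  rcases eq_or_ne z 0 with rfl | h0
  · left; simp [pol_zero]
  rcases eq_or_lt_of_le hψ.1 with rfl | h1
  · exact Or.inl h
  rcases eq_or_lt_of_le hψ.2 with rfl | h2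
  · exact Or.inr h
  exact absurd (h ▸ pol_mem_sec hα hβ (norm_pos_iff.2 h0) ⟨h1, h2⟩) hns

/-! ### Gluing convex sets along a set with controlled frontier -/

lemma exists_frontier_segment {S : Set ℂ} {u w : ℂ} (hu : u ∉ S) (hw : w ∈ S) :
    ∃ p ∈ segment ℝ u w, p ∈ frontier S := by
  by_contra! h
  have hp : IsPreconnected (segment ℝ u w) := (convex_segment u w).isPreconnected
  have hcov : segment ℝ u w ⊆ interior S ∪ (closure S)ᶜ := by
    intro r hr
    by_cases hrc : r ∈ closure S
    · left
      by_contra hri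
      exact h r hr ⟨hrc, hri⟩
    · exact Or.inr hrc
  have h1 : (segment ℝ u w ∩ interior S).Nonempty := by
    refine ⟨w, right_mem_segment ℝ u w, ?_⟩
    rcases hcov (right_mem_segment ℝ u w) with h' | h'
    · exact h'
    · exact absurd (subset_closure hw) h'
  have h2 : (segment ℝ u w ∩ (closure S)ᶜ).Nonempty := by
    refine ⟨u, left_mem_segment ℝ u w, ?_⟩
    rcases hcov (left_mem_segment ℝ u w) with h' | h'
    · exact absurd (interior_subset h') hu
    · exact h'
  obtain ⟨r, -, hr1, hr2⟩ := hp _ _ isOpen_interior isClosed_closure.isOpen_compl hcov h1 h2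
  exact hr2 (subset_closure (interior_subset hr1))

/-- Let w in S lie on a segment from u to v in the glued set. An endpoint in S is already in E; if
an endpoint is outside S, the segment from it to w crosses the frontier of S, at a point of D and
hence of E. So w lies between two points of E. -/
lemma convex_glue {D E S : Set ℂ} (hD : Convex ℝ D) (hE : Convex ℝ E)
    (hS : frontier S ∩ D ⊆ E) : Convex ℝ {z | z ∈ D ∧ (z ∈ S → z ∈ E)} := by
  rw [convex_iff_segment_subset]
  rintro u ⟨huD, huE⟩ v ⟨hvD, hvE⟩ w hw
  have hwD := hD.segment_subset huD hvD hw
  refine ⟨hwD, fun hwS => ?_⟩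
  have key : ∀ x ∈ D, (x ∈ S → x ∈ E) → ∃ p ∈ segment ℝ x w, p ∈ E := by
    intro x hxD hxE
    by_cases hxS : x ∈ S
    · exact ⟨x, left_mem_segment ℝ x w, hxE hxS⟩
    · obtain ⟨p, hp, hpS⟩ := exists_frontier_segment hxS hwS
      exact ⟨p, hp, hS ⟨hpS, hD.segment_subset hxD hwD hp⟩⟩
  obtain ⟨p, hp, hpE⟩ := key u huD huE
  obtain ⟨q, hq, hqE⟩ := key v hvD hvE
  refine hE.segment_subset hpE hqE ?_
  rw [mem_segment_iff_wbtw] at *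
  exact ((hw.trans_left_right hp).symm.trans_left_right hq).symm

/-- On the circle, a direction τ outside (α, β) is at least as far from ψ as one of α and β, so its
cosine is no larger. Thus, within a sector, the tangents at the two ends imply all the tangents at
directions outside it. -/
lemma mul_cos_sub_le {r d ψ τ α β : ℝ} (hr : 0 ≤ r) (hα : -Real.pi ≤ α) (hβ : β ≤ Real.pi)
    (hψ : ψ ∈ Icc α β) (hτ : τ ∈ Icc (-Real.pi) Real.pi) (hτ' : τ ∉ Ioo α β)
    (h1 : r * Real.cos (ψ - α) ≤ d) (h2 : r * Real.cos (ψ - β) ≤ d) :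
    r * Real.cos (ψ - τ) ≤ d := by
  obtain ⟨hψ1, hψ2⟩ := hψ
  obtain ⟨hτ1, hτ2⟩ := hτ
  have hcase : τ ≤ α ∨ β ≤ τ := by
    by_contra! h
    exact hτ' h
  have e1 : Real.cos (ψ - τ) = Real.cos (τ - ψ) := by rw [← Real.cos_neg, neg_sub]
  have e2 : Real.cos (ψ - β) = Real.cos (β - ψ) := by rw [← Real.cos_neg, neg_sub]
  have e3 : Real.cos (ψ - τ) = Real.cos (2 * Real.pi - (ψ - τ)) := by
    rw [Real.cos_two_pi_sub]
  have e4 : Real.cos (ψ - τ) = Real.cos (2 * Real.pi - (τ - ψ)) := by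
    rw [Real.cos_two_pi_sub, e1]
  have hπ := Real.pi_pos
  rcases hcase with h | h
  · rcases le_total (ψ - τ) Real.pi with h' | h'
    · refine (mul_le_mul_of_nonneg_left ?_ hr).trans h1
      exact Real.cos_le_cos_of_nonneg_of_le_pi (by linarith) h' (by linarith)
    · refine (mul_le_mul_of_nonneg_left ?_ hr).trans h2
      rw [e2, e3]
      exact Real.cos_le_cos_of_nonneg_of_le_pi (by linarith) (by linarith) (by linarith)
  · rcases le_total (τ - ψ) Real.pi with h' | h'
    · refine (mul_le_mul_of_nonneg_left ?_ hr).trans h2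
      rw [e2, e1]
      exact Real.cos_le_cos_of_nonneg_of_le_pi (by linarith) h' (by linarith)
    · refine (mul_le_mul_of_nonneg_left ?_ hr).trans h1
      rw [e4]
      exact Real.cos_le_cos_of_nonneg_of_le_pi (by linarith) (by linarith) (by linarith)

/-- Convex sets prescribed in consecutive sectors, which meet at points of the circle of radius
`ρ` and stay there below the tangents to this circle, glue to a convex set. -/
theorem exists_glue {a b ρ : ℝ} (hρ : 0 ≤ ρ) (haρ : a ≤ ρ) (hρb : ρ ≤ b) (n : ℕ)
    (v : ℕ → ℝ) (hv : Monotone v) (hv0 : v 0 = -Real.pi) (hvn : v n = Real.pi)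
    (E : ℕ → Set ℂ) (hE : ∀ i < n, Convex ℝ (E i)) (hE0 : ∀ i < n, 0 ∈ E i)
    (hEl : ∀ i < n, pol ρ (v i) ∈ E i) (hEr : ∀ i < n, pol ρ (v (i + 1)) ∈ E i)
    (hEt : ∀ i < n, ∀ z ∈ E i, z ∈ sec (v i) (v (i + 1)) →
      z ∈ hp ρ (v i) ∧ z ∈ hp ρ (v (i + 1)))
    (hEa : ∀ i < n, ∀ z ∈ disc a, z ∈ sec (v i) (v (i + 1)) → z ∈ E i)
    (hEb : ∀ i < n, ∀ z ∈ E i, z ∈ sec (v i) (v (i + 1)) → z ∈ disc b) :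
    ∃ Ω ∈ classC a b, ∀ i < n, Ω ∩ sec (v i) (v (i + 1)) = E i ∩ sec (v i) (v (i + 1)) := by
  have hvl : ∀ i ≤ n, -Real.pi ≤ v i := fun i _ => hv0 ▸ hv (Nat.zero_le i)
  have hvr : ∀ i ≤ n, v i ≤ Real.pi := fun i hi => hvn ▸ hv hi
  have hsec : ∀ i < n, ∀ j < n, ∀ z ∈ sec (v i) (v (i + 1)), z ∈ sec (v j) (v (j + 1)) →
      i = j := by
    intro i _ j _ z hi hj
    by_contra hij
    exact Set.disjoint_left.1 (hv.pairwise_disjoint_on_Ioo_succ hij) hi.2 hj.2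
  have hall : ∀ i < n, ∀ z ∈ E i, z ∈ sec (v i) (v (i + 1)) → ∀ j ≤ n, z ∈ hp ρ (v j) := by
    intro i hi z hz hzs j hj
    obtain ⟨h1, h2⟩ := hEt i hi z hz hzs
    obtain ⟨r, ψ, hr, hψ, rfl⟩ := exists_pol_of_mem_sec hzs
    rw [pol_mem_hp] at *
    refine mul_cos_sub_le hr.le (hvl i hi.le) (hvr (i + 1) hi) ⟨hψ.1.le, hψ.2.le⟩
      ⟨hvl j hj, hvr j hj⟩ ?_ h1 h2
    rintro ⟨h3, h4⟩
    have := hv.reflect_lt h3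
    have := hv.reflect_lt h4
    omega
  -- All the tangents at junctions are imposed everywhere. By `hall` this removes nothing from the
  -- pieces, and it exhibits the set as an intersection of sets covered by `convex_glue`.
  set Ω : Set ℂ := {z | (∀ j ≤ n, z ∈ hp ρ (v j)) ∧
    ∀ i < n, z ∈ sec (v i) (v (i + 1)) → z ∈ E i} with hΩ
  refine ⟨Ω, ⟨?_, ?_, ?_⟩, ?_⟩
  · have hrep : Ω = (⋂ j ∈ Iic n, hp ρ (v j)) ∩ ⋂ i ∈ Iio n,
        {z | z ∈ hp ρ (v i) ∩ hp ρ (v (i + 1)) ∧ (z ∈ sec (v i) (v (i + 1)) → z ∈ E i)} := by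
      ext z
      simp only [hΩ, mem_inter_iff, mem_iInter, mem_Iic, mem_Iio, mem_ofPred_eq]
      constructor
      · rintro ⟨h1, h2⟩
        exact ⟨h1, fun i hi => ⟨⟨h1 i hi.le, h1 (i + 1) hi⟩, h2 i hi⟩⟩
      · rintro ⟨h1, h2⟩
        exact ⟨h1, fun i hi => (h2 i hi).2⟩
    rw [hrep]
    refine (convex_iInter₂ fun j _ => convex_hp ρ (v j)).inter (convex_iInter₂ fun i hi => ?_)
    refine convex_glue ((convex_hp _ _).inter (convex_hp _ _)) (hE i hi) ?_
    have hray : ∀ z : ℂ, ∀ τ, z = pol ‖z‖ τ → z ∈ hp ρ τ → pol ρ τ ∈ E i → z ∈ E i := by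
      intro z τ hz hzt hτ
      rw [hz, pol_mem_hp, sub_self, Real.cos_zero, mul_one] at hzt
      rcases hρ.eq_or_lt with h0 | h0
      · have : ‖z‖ = 0 := le_antisymm (hzt.trans h0.symm.le) (norm_nonneg z)
        rw [norm_eq_zero.1 this]
        exact hE0 i hi
      · have := (hE i hi).smul_mem_of_zero_mem (hE0 i hi) hτ (t := ‖z‖ / ρ)
          ⟨by positivity, (div_le_one h0).2 hzt⟩
        rwa [smul_pol, div_mul_cancel₀ _ h0.ne', ← hz] at this
    rintro z ⟨hz, hz1, hz2⟩
    rcases frontier_sec (hvl i (le_of_lt hi)) (hvr (i + 1) hi) hz with h | h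
    · exact hray z _ h hz1 (hEl i hi)
    · exact hray z _ h hz2 (hEr i hi)
  · exact fun z hz => ⟨fun j _ => disc_subset_hp haρ hz, fun i hi hs => hEa i hi z hz hs⟩
  · rintro z ⟨hz1, hz2⟩
    by_cases hs : ∃ i < n, z ∈ sec (v i) (v (i + 1))
    · obtain ⟨i, hi, hs⟩ := hs
      exact hEb i hi z (hz2 i hi hs) hs
    · push Not at hs
      rcases eq_or_ne z 0 with rfl | h0
      · simpa [disc] using hρ.trans hρb
      have hza : z.arg ∈ ⋃ i ∈ Ico 0 n, Ioc (v i) (v (i + 1)) := by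
        have := hv.biUnion_Ico_Ioc_map_succ 0 n
        simp only [Order.succ_eq_add_one] at this
        rw [this, hv0, hvn]
        exact Complex.arg_mem_Ioc z
      simp only [mem_iUnion] at hza
      obtain ⟨i, hi, hzi⟩ := hza
      have hz' : z.arg = v (i + 1) := by
        by_contra hne
        exact hs i hi.2 ⟨h0, hzi.1, lt_of_le_of_ne hzi.2 hne⟩
      have := hz1 (i + 1) hi.2
      rw [← pol_arg z, hz', pol_mem_hp, sub_self, Real.cos_zero, mul_one] at this
      simpa [disc] using this.trans hρb
  · intro i hi
    ext z
    constructor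
    · rintro ⟨hz, hs⟩
      exact ⟨hz.2 i hi hs, hs⟩
    · rintro ⟨hz, hs⟩
      refine ⟨⟨hall i hi z hz hs, fun j hj hs' => ?_⟩, hs⟩
      obtain rfl := hsec i hi j hj z hs hs'
      exact hz

/-! ### Frontiers and perimeters -/

lemma zero_mem_interior {a b : ℝ} (ha : 0 < a) {Ω : Set ℂ} (hΩ : Ω ∈ classC a b) :
    (0 : ℂ) ∈ interior Ω :=
  interior_maximal (Metric.ball_subset_closedBall.trans hΩ.2.1) Metric.isOpen_ball
    (Metric.mem_ball_self ha)

lemma smul_mem_interior {a b : ℝ} (ha : 0 < a) {Ω : Set ℂ} (hΩ : Ω ∈ classC a b) {z : ℂ}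
    (hz : z ∈ closure Ω) {s : ℝ} (hs0 : 0 ≤ s) (hs1 : s < 1) : s • z ∈ interior Ω := by
  rcases hs0.eq_or_lt with rfl | hs0
  · simpa using zero_mem_interior ha hΩ
  refine hΩ.1.openSegment_interior_closure_subset_interior (zero_mem_interior ha hΩ) hz ?_
  exact ⟨1 - s, s, by linarith, hs0, by ring, by simp⟩

lemma not_mem_frontier_of_lt {a b : ℝ} (ha : 0 < a) {Ω : Set ℂ} (hΩ : Ω ∈ classC a b)
    {r R ψ : ℝ} (hr : 0 ≤ r) (hrR : r < R) (hR : pol R ψ ∈ closure Ω) :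
    pol r ψ ∉ frontier Ω := by
  have hR0 : 0 < R := hr.trans_lt hrR
  have := smul_mem_interior ha hΩ hR (s := r / R) (by positivity) ((div_lt_one hR0).2 hrR)
  rw [smul_pol, div_mul_cancel₀ _ hR0.ne'] at this
  exact fun h => h.2 this

lemma norm_pos_of_mem_frontier {a b : ℝ} (ha : 0 < a) {Ω : Set ℂ} (hΩ : Ω ∈ classC a b) {z : ℂ}
    (hz : z ∈ frontier Ω) : 0 < ‖z‖ := by
  rw [norm_pos_iff]
  rintro rfl
  exact hz.2 (zero_mem_interior ha hΩ)

/-- The boundary is the radial graph of 1/gauge over the unit circle. The gauge is Lipschitz with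
constant 1/a and at least 1/b on this circle, so the graph is a Lipschitz image of a bounded
interval. Finiteness matters because `toReal` sends `⊤` to 0, which would spoil additivity. -/
lemma hausdorffMeasure_frontier_lt_top {a b : ℝ} (ha : 0 < a) (hab : a < b) {Ω : Set ℂ}
    (hΩ : Ω ∈ classC a b) : Measure.hausdorffMeasure 1 (frontier Ω) < ⊤ := by
  have hb : 0 < b := ha.trans hab
  have h0 : Ω ∈ nhds (0 : ℂ) := mem_interior_iff_mem_nhds.1 (zero_mem_interior ha hΩ)
  set g := gauge Ω
  have hgl : LipschitzWith a.toNNReal⁻¹ g :=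
    hΩ.1.lipschitzWith_gauge (Real.toNNReal_pos.2 ha)
      (by rw [Real.coe_toNNReal a ha.le]; exact Metric.ball_subset_closedBall.trans hΩ.2.1)
  have hgl' : ∀ z w, |g z - g w| ≤ a⁻¹ * ‖z - w‖ := fun z w => by
    have := hgl.dist_le_mul z w
    rwa [Real.dist_eq, dist_eq_norm, NNReal.coe_inv, Real.coe_toNNReal a ha.le] at this
  have hgb : ∀ z : ℂ, ‖z‖ = 1 → 1 / b ≤ g z := by
    intro z hz
    have := le_gauge_of_subset_closedBall (absorbent_nhds_zero h0) hb.le hΩ.2.2 (x := z)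
    rwa [hz] at this
  set F : ℝ → ℂ := fun ψ => (g (pol 1 ψ))⁻¹ • pol 1 ψ
  have hn : ∀ ψ, ‖pol 1 ψ‖ = 1 := fun ψ => by rw [norm_pol, abs_one]
  have hpl : ∀ ψ φ, ‖pol 1 ψ - pol 1 φ‖ ≤ |ψ - φ| := by
    intro ψ φ
    have := (lipschitzWith_circleMap 0 1).dist_le_mul ψ φ
    simpa [circleMap, dist_eq_norm, Real.dist_eq, pol_eq_exp] using this
  have hF : LipschitzWith (b + b * b * a⁻¹).toNNReal F := by
    refine LipschitzWith.of_dist_le_mul fun ψ φ => ?_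
    rw [Real.coe_toNNReal _ (by positivity), dist_eq_norm, Real.dist_eq]
    have e : F ψ - F φ = (g (pol 1 ψ))⁻¹ • (pol 1 ψ - pol 1 φ)
        + ((g (pol 1 ψ))⁻¹ - (g (pol 1 φ))⁻¹) • pol 1 φ := by
      simp only [F, smul_sub, sub_smul]
      abel
    have p1 := hgb _ (hn ψ)
    have p2 := hgb _ (hn φ)
    have q1 : 0 < g (pol 1 ψ) := lt_of_lt_of_le (by positivity) p1
    have q2 : 0 < g (pol 1 φ) := lt_of_lt_of_le (by positivity) p2
    have i1 : (g (pol 1 ψ))⁻¹ ≤ b := by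
      rw [inv_le_comm₀ q1 hb]; simpa using p1
    have i2 : (g (pol 1 φ))⁻¹ ≤ b := by
      rw [inv_le_comm₀ q2 hb]; simpa using p2
    have hd : |(g (pol 1 ψ))⁻¹ - (g (pol 1 φ))⁻¹| ≤ b * b * (a⁻¹ * |ψ - φ|) := by
      have : (g (pol 1 ψ))⁻¹ - (g (pol 1 φ))⁻¹
          = (g (pol 1 ψ))⁻¹ * (g (pol 1 φ))⁻¹ * (g (pol 1 φ) - g (pol 1 ψ)) := by
        field_simp
      rw [this, abs_mul, abs_of_pos (by positivity), abs_sub_comm]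
      gcongr
      refine (hgl' _ _).trans ?_
      gcongr
      exact hpl ψ φ
    rw [e]
    refine (norm_add_le _ _).trans ?_
    rw [norm_smul, norm_smul, hn, mul_one, Real.norm_eq_abs, Real.norm_eq_abs,
      abs_of_pos (inv_pos.2 q1)]
    calc _ ≤ b * |ψ - φ| + b * b * (a⁻¹ * |ψ - φ|) := by
          gcongr
          exact hpl ψ φ
      _ = (b + b * b * a⁻¹) * |ψ - φ| := by ring
  have hsub : frontier Ω ⊆ F '' Ioc (-Real.pi) Real.pi := by
    intro z hz
    have hz0 := norm_pos_of_mem_frontier ha hΩ hz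
    have hg : g z = 1 := (gauge_eq_one_iff_mem_frontier hΩ.1 h0).2 hz
    refine ⟨z.arg, Complex.arg_mem_Ioc z, ?_⟩
    have h1 : z = ‖z‖ • pol 1 z.arg := by rw [smul_pol, mul_one, pol_arg]
    have h2 : g z = ‖z‖ * g (pol 1 z.arg) := by
      conv_lhs => rw [h1]
      exact gauge_smul_of_nonneg hz0.le _
    have h3 : (g (pol 1 z.arg))⁻¹ = ‖z‖ := by
      rw [hg] at h2
      exact (eq_inv_of_mul_eq_one_left h2.symm).symm
    simp only [F]
    rw [h3, ← h1]
  refine (measure_mono hsub).trans_lt ?_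
  refine (hF.hausdorffMeasure_image_le zero_le_one _).trans_lt ?_
  rw [hausdorffMeasure_real, Real.volume_Ioc]
  exact ENNReal.mul_lt_top (ENNReal.rpow_lt_top_of_nonneg zero_le_one ENNReal.coe_ne_top) ENNReal.ofReal_lt_top

lemma volume_lt_top {a b : ℝ} {Ω : Set ℂ} (hΩ : Ω ∈ classC a b) : volume Ω < ⊤ :=
  (measure_mono hΩ.2.2).trans_lt measure_closedBall_lt_top

/-- The closed ray in direction `ψ`. -/
def ray (ψ : ℝ) : Set ℂ := {z | z = pol ‖z‖ ψ}

lemma volume_ray (ψ : ℝ) : volume (ray ψ) = 0 := by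
  have hs : Submodule.span ℝ {pol 1 ψ} ≠ ⊤ := by
    intro h
    have h1 := finrank_span_singleton (K := ℝ) (v := pol 1 ψ)
      (by rw [← norm_ne_zero_iff, norm_pol]; simp)
    rw [h, finrank_top, Complex.finrank_real_complex] at h1
    norm_num at h1
  refine measure_mono_null (fun z hz => ?_) (Measure.addHaar_submodule volume _ hs)
  refine Submodule.mem_span_singleton.2 ⟨‖z‖, ?_⟩
  rw [smul_pol, mul_one]
  exact hz.symm

/-- A point of the closure, shrunk towards the interior point 0, becomes interior; hence each ray
carries at most one boundary point. -/
lemma hausdorffMeasure_frontier_ray {a b : ℝ} (ha : 0 < a) {Ω : Set ℂ} (hΩ : Ω ∈ classC a b)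
    (ψ : ℝ) : Measure.hausdorffMeasure 1 (frontier Ω ∩ ray ψ) = 0 := by
  have hsub : (frontier Ω ∩ ray ψ).Subsingleton := by
    have key : ∀ z ∈ frontier Ω ∩ ray ψ, ∀ w ∈ frontier Ω ∩ ray ψ, ‖w‖ ≤ ‖z‖ := by
      rintro z ⟨hz, hzr⟩ w ⟨hw, hwr⟩
      by_contra! h
      have hwr' : w = pol ‖w‖ ψ := hwr
      have hzr' : z = pol ‖z‖ ψ := hzr
      have hw' := hw.1
      rw [hwr'] at hw'
      rw [hzr'] at hz
      exact not_mem_frontier_of_lt ha hΩ (norm_nonneg z) h hw' hz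
    intro z hz w hw
    have e : ‖z‖ = ‖w‖ := le_antisymm (key w hw z hz) (key z hz w hw)
    have h1 : z = pol ‖z‖ ψ := hz.2
    have h2 : w = pol ‖w‖ ψ := hw.2
    rw [h1, h2, e]
  have : NullSingletonClass (Measure.hausdorffMeasure 1 : Measure ℂ) :=
    Measure.nullSingletonClass_hausdorff ℂ zero_lt_one
  exact hsub.measure_zero _

/-! ### The functional in a sector -/

/-- The contribution of the sector `(α, β)` to `J`. -/
def Jl (lam : ℝ) (Ω : Set ℂ) (α β : ℝ) : ℝ :=
  lam * (volume (Ω ∩ sec α β)).toReal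
    - (Measure.hausdorffMeasure 1 (frontier Ω ∩ sec α β)).toReal

lemma measure_inter_sec_add {μ : Measure ℂ} {A : Set ℂ} (hA : μ A < ⊤) {α β γ : ℝ}
    (hαβ : α ≤ β) (hβγ : β ≤ γ) (hγ : γ ≤ Real.pi)
    (h0 : μ (A ∩ ray β) = 0) :
    (μ (A ∩ sec α γ)).toReal = (μ (A ∩ sec α β)).toReal + (μ (A ∩ sec β γ)).toReal := by
  have hfin : ∀ s, μ (A ∩ s) ≠ ⊤ := fun s => ((measure_mono inter_subset_left).trans_lt hA).ne
  have hdis : Disjoint (A ∩ sec α β) (A ∩ sec β γ) := by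
    rw [Set.disjoint_left]
    rintro z ⟨-, hz⟩ ⟨-, hz'⟩
    exact lt_asymm hz.2.2 hz'.2.1
  have hm : μ (A ∩ sec α β ∪ A ∩ sec β γ) = μ (A ∩ sec α β) + μ (A ∩ sec β γ) := by
    rw [← inter_union_distrib_left]
    have hms : MeasurableSet (sec α β) := (isOpen_sec (hβγ.trans hγ)).measurableSet
    rw [← measure_inter_add_sdiff (A ∩ (sec α β ∪ sec β γ)) hms]
    congr 2
    · ext z
      simp only [mem_inter_iff, mem_union]
      tauto
    · ext z
      simp only [mem_inter_iff, mem_union, mem_sdiff]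
      constructor
      · tauto
      · rintro ⟨hzA, hz⟩
        exact ⟨⟨hzA, Or.inr hz⟩, fun hz' => lt_asymm hz'.2.2 hz.2.1⟩
  rw [← ENNReal.toReal_add (hfin _) (hfin _), ← hm]
  congr 1
  refine le_antisymm ?_ (measure_mono ?_)
  · calc μ (A ∩ sec α γ) ≤ μ ((A ∩ sec α β ∪ A ∩ sec β γ) ∪ A ∩ ray β) := by
          refine measure_mono ?_
          rintro z ⟨hz, hz0, hz1, hz2⟩
          rcases lt_trichotomy z.arg β with h | h | h
          · exact Or.inl (Or.inl ⟨hz, hz0, hz1, h⟩)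
          · refine Or.inr ⟨hz, ?_⟩
            change z = pol ‖z‖ β
            rw [← h, pol_arg]
          · exact Or.inl (Or.inr ⟨hz, hz0, h, hz2⟩)
      _ ≤ _ := (measure_union_le _ _).trans (by rw [h0, add_zero])
  · rintro z (⟨hz, hz0, hz1, hz2⟩ | ⟨hz, hz0, hz1, hz2⟩)
    · exact ⟨hz, hz0, hz1, hz2.trans_le hβγ⟩
    · exact ⟨hz, hz0, hαβ.trans_lt hz1, hz2⟩

lemma Jl_add {a b lam : ℝ} (ha : 0 < a) (hab : a < b) {Ω : Set ℂ} (hΩ : Ω ∈ classC a b)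
    {α β γ : ℝ} (hαβ : α ≤ β) (hβγ : β ≤ γ) (hγ : γ ≤ Real.pi) :
    Jl lam Ω α γ = Jl lam Ω α β + Jl lam Ω β γ := by
  unfold Jl
  rw [measure_inter_sec_add (volume_lt_top hΩ) hαβ hβγ hγ
      (measure_mono_null inter_subset_right (volume_ray β)),
    measure_inter_sec_add (hausdorffMeasure_frontier_lt_top ha hab hΩ) hαβ hβγ hγ
      (hausdorffMeasure_frontier_ray ha hΩ β)]
  ring

lemma measure_eq_inter_sec {μ : Measure ℂ} {A : Set ℂ} (h0 : μ (A ∩ ray Real.pi) = 0) :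
    μ A = μ (A ∩ sec (-Real.pi) Real.pi) := by
  refine le_antisymm ?_ (measure_mono inter_subset_left)
  calc μ A ≤ μ (A ∩ sec (-Real.pi) Real.pi ∪ A ∩ ray Real.pi) := by
        refine measure_mono fun z hz => ?_
        rcases eq_or_ne z 0 with rfl | hz0
        · refine Or.inr ⟨hz, ?_⟩
          change (0 : ℂ) = pol ‖(0 : ℂ)‖ Real.pi
          simp [pol_zero]
        rcases (Complex.arg_le_pi z).eq_or_lt with h | h
        · refine Or.inr ⟨hz, ?_⟩
          change z = pol ‖z‖ Real.pi
          rw [← h, pol_arg]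
        · exact Or.inl ⟨hz, hz0, Complex.neg_pi_lt_arg z, h⟩
    _ ≤ _ := (measure_union_le _ _).trans (by rw [h0, add_zero])

lemma J_eq_Jl {a b lam : ℝ} (ha : 0 < a) {Ω : Set ℂ} (hΩ : Ω ∈ classC a b) :
    J lam Ω = Jl lam Ω (-Real.pi) Real.pi := by
  unfold J Jl perimeter
  rw [← measure_eq_inter_sec (measure_mono_null inter_subset_right (volume_ray _)),
    ← measure_eq_inter_sec (hausdorffMeasure_frontier_ray ha hΩ _)]

lemma Jl_congr {lam α β : ℝ} (hβ : β ≤ Real.pi) {Ω Ω' : Set ℂ}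
    (h : Ω ∩ sec α β = Ω' ∩ sec α β) : Jl lam Ω α β = Jl lam Ω' α β := by
  unfold Jl
  rw [h, ← frontier_inter_open_inter (isOpen_sec hβ), h,
    frontier_inter_open_inter (isOpen_sec hβ)]

/-! ### Rotations -/

/-- The rotation by the angle `s`. -/
def rot (s : ℝ) : ℂ ≃ₗᵢ[ℝ] ℂ := rotation (Circle.exp s)

lemma rot_pol (s r ψ : ℝ) : rot s (pol r ψ) = pol r (ψ + s) := by
  rw [rot, rotation_apply, Circle.coe_exp, pol_eq_exp, pol_eq_exp]
  push_cast
  rw [add_mul, Complex.exp_add]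
  ring

lemma pol_mem_rot {s r ψ : ℝ} {Ω : Set ℂ} : pol r ψ ∈ rot s '' Ω ↔ pol r (ψ - s) ∈ Ω := by
  rw [show pol r ψ = rot s (pol r (ψ - s)) by rw [rot_pol, sub_add_cancel],
    (rot s).injective.mem_set_image]

lemma rot_disc (s r : ℝ) : rot s '' disc r = disc r := by
  simp [disc]

lemma rot_mem_classC {a b s : ℝ} {Ω : Set ℂ} (hΩ : Ω ∈ classC a b) :
    rot s '' Ω ∈ classC a b := by
  refine ⟨hΩ.1.linear_image (rot s).toLinearEquiv.toLinearMap, ?_, ?_⟩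
  · rw [← rot_disc s a]
    exact image_mono hΩ.2.1
  · rw [← rot_disc s b]
    exact image_mono hΩ.2.2

lemma rot_frontier (s : ℝ) (Ω : Set ℂ) : frontier (rot s '' Ω) = rot s '' frontier Ω :=
  ((rot s).toHomeomorph.image_frontier Ω).symm

lemma volume_rot (s : ℝ) (A : Set ℂ) : volume (rot s '' A) = volume A := by
  have := (rot s).symm.measurePreserving.measure_preimage_equiv
    (f := (rot s).symm.toHomeomorph.toMeasurableEquiv) A
  rw [← this]
  congr 1
  exact (rot s).toEquiv.image_eq_preimage_symm A

lemma hausdorffMeasure_rot (s : ℝ) (A : Set ℂ) :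
    Measure.hausdorffMeasure 1 (rot s '' A) = Measure.hausdorffMeasure 1 A :=
  (rot s).isometry.hausdorffMeasure_image (Or.inl zero_le_one) A

lemma J_rot (lam s : ℝ) (Ω : Set ℂ) : J lam (rot s '' Ω) = J lam Ω := by
  unfold J perimeter
  rw [rot_frontier, volume_rot, hausdorffMeasure_rot]

lemma rot_sec {s α β : ℝ} (hα : -Real.pi ≤ α) (hβ : β ≤ Real.pi) (hα' : -Real.pi ≤ α + s)
    (hβ' : β + s ≤ Real.pi) : rot s '' sec α β = sec (α + s) (β + s) := by
  ext z
  constructor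
  · rintro ⟨w, hw, rfl⟩
    obtain ⟨r, ψ, hr, hψ, rfl⟩ := exists_pol_of_mem_sec hw
    rw [rot_pol]
    exact pol_mem_sec hα' hβ' hr ⟨by linarith [hψ.1], by linarith [hψ.2]⟩
  · intro hz
    obtain ⟨r, ψ, hr, hψ, rfl⟩ := exists_pol_of_mem_sec hz
    rw [pol_mem_rot]
    exact pol_mem_sec hα hβ hr ⟨by linarith [hψ.1], by linarith [hψ.2]⟩

lemma Jl_rot {lam s α β : ℝ} (hα : -Real.pi ≤ α) (hβ : β ≤ Real.pi) (hα' : -Real.pi ≤ α + s)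
    (hβ' : β + s ≤ Real.pi) (Ω : Set ℂ) :
    Jl lam (rot s '' Ω) (α + s) (β + s) = Jl lam Ω α β := by
  unfold Jl
  rw [rot_frontier, ← rot_sec hα hβ hα' hβ', ← image_inter (rot s).injective,
    ← image_inter (rot s).injective, volume_rot, hausdorffMeasure_rot]

lemma rot_hp (s d v : ℝ) : rot s '' hp d v = hp d (v + s) := by
  ext z
  rw [← pol_arg z, pol_mem_rot, pol_mem_hp, pol_mem_hp]
  ring_nf

/-! ### Half-planes -/

lemma mem_sec_iff {α β : ℝ} (hα : -(Real.pi / 2) < α) (hαβ : α ≤ β) (hβ : β < Real.pi / 2)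
    (z : ℂ) : z ∈ sec α β ↔ 0 < z.re ∧ z.im ∈ Ioo (Real.tan α * z.re) (Real.tan β * z.re) := by
  have hπ := Real.pi_pos
  constructor
  · intro hz
    obtain ⟨r, ψ, hr, hψ, rfl⟩ := exists_pol_of_mem_sec hz
    have hc : 0 < Real.cos ψ :=
      Real.cos_pos_of_mem_Ioo ⟨by linarith [hψ.1], by linarith [hψ.2]⟩
    have h1 : Real.tan α < Real.tan ψ :=
      Real.tan_lt_tan_of_lt_of_lt_pi_div_two hα (by linarith [hψ.2]) hψ.1
    have h2 : Real.tan ψ < Real.tan β :=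
      Real.tan_lt_tan_of_lt_of_lt_pi_div_two (by linarith [hψ.1]) hβ hψ.2
    have e : r * Real.sin ψ = Real.tan ψ * (r * Real.cos ψ) := by
      rw [Real.tan_eq_sin_div_cos]
      field_simp
    simp only [pol_re, pol_im, e]
    exact ⟨by positivity, mul_lt_mul_of_pos_right h1 (by positivity),
      mul_lt_mul_of_pos_right h2 (by positivity)⟩
  · rintro ⟨h0, h1, h2⟩
    have hz : z ≠ 0 := by
      rintro rfl
      simp at h0
    have ha : |z.arg| < Real.pi / 2 :=
      Complex.abs_arg_lt_pi_div_two_iff.2 (Or.inl h0)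
    rw [abs_lt] at ha
    have ht : Real.tan z.arg * z.re = z.im := by
      rw [Complex.tan_arg]
      field_simp
    rw [← ht] at h1 h2
    have h1' := lt_of_mul_lt_mul_right h1 h0.le
    have h2' := lt_of_mul_lt_mul_right h2 h0.le
    refine ⟨hz, ?_, ?_⟩
    · exact (Real.strictMonoOn_tan.lt_iff_lt ⟨hα, by linarith⟩ ha).1 h1'
    · exact (Real.strictMonoOn_tan.lt_iff_lt ha ⟨by linarith, hβ⟩).1 h2'

lemma Jl_hp_zero {lam d α β : ℝ} (hd : 0 < d) (hα : -(Real.pi / 2) < α) (hαβ : α ≤ β)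
    (hβ : β < Real.pi / 2) :
    Jl lam (hp d 0) α β = (lam * d ^ 2 / 2 - d) * (Real.tan β - Real.tan α) := by
  have hmono : Real.tan α ≤ Real.tan β :=
    Real.strictMonoOn_tan.monotoneOn ⟨hα, by linarith⟩ ⟨by linarith, hβ⟩ hαβ
  have hhp : hp d 0 = {z : ℂ | z.re ≤ d} := by
    ext z
    simp [mem_hp]
  have hvol : (volume (hp d 0 ∩ sec α β)).toReal = d ^ 2 / 2 * (Real.tan β - Real.tan α) := by
    have hset : hp d 0 ∩ sec α β = Complex.measurableEquivRealProd ⁻¹'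
        regionBetween (fun x => Real.tan α * x) (fun x => Real.tan β * x) (Ioc 0 d) := by
      ext z
      rw [mem_inter_iff, mem_sec_iff hα hαβ hβ, hhp]
      simp only [regionBetween, mem_preimage, mem_ofPred_eq, mem_Ioc, mem_Ioo,
        Complex.measurableEquivRealProd_apply]
      tauto
    rw [hset, Complex.volume_preserving_equiv_real_prod.measure_preimage_equiv,
      Measure.volume_eq_prod, volume_regionBetween_eq_integral]
    · rw [← intervalIntegral.integral_of_le hd.le]
      have : ∫ y in (0 : ℝ)..d, ((fun x => Real.tan β * x) - fun x => Real.tan α * x) y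
          = d ^ 2 / 2 * (Real.tan β - Real.tan α) := by
        have e : ((fun x => Real.tan β * x) - fun x => Real.tan α * x)
            = fun x : ℝ => (Real.tan β - Real.tan α) * x := by
          ext x
          simp [sub_mul]
        rw [e, intervalIntegral.integral_const_mul, integral_id]
        ring
      rw [this, ENNReal.toReal_ofReal]
      exact mul_nonneg (by positivity) (sub_nonneg.2 hmono)
    · exact (continuous_const.mul continuous_id).continuousOn.integrableOn_Icc.mono_set
        Ioc_subset_Icc_self
    · exact (continuous_const.mul continuous_id).continuousOn.integrableOn_Icc.mono_set
        Ioc_subset_Icc_self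
    · exact measurableSet_Ioc
    · exact fun x hx => mul_le_mul_of_nonneg_right hmono hx.1.le
  have hper : (Measure.hausdorffMeasure 1 (frontier (hp d 0) ∩ sec α β)).toReal
      = d * (Real.tan β - Real.tan α) := by
    have hset : frontier (hp d 0) ∩ sec α β
        = (fun y : ℝ => (⟨d, y⟩ : ℂ)) '' Ioo (Real.tan α * d) (Real.tan β * d) := by
      ext z
      rw [mem_inter_iff, mem_sec_iff hα hαβ hβ, hhp, Complex.frontier_setOfPred_re_le]
      simp only [mem_image]
      constructor
      · rintro ⟨h0, -, h2⟩
        have h0 : z.re = d := h0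
        rw [h0] at h2
        exact ⟨z.im, h2, Complex.ext h0.symm rfl⟩
      · rintro ⟨y, hy, rfl⟩
        exact ⟨rfl, hd, hy⟩
    have hiso : Isometry fun y : ℝ => (⟨d, y⟩ : ℂ) := by
      refine Isometry.of_dist_eq fun x y => ?_
      rw [Complex.dist_of_re_eq (by rfl)]
    rw [hset, hiso.hausdorffMeasure_image (Or.inl zero_le_one), hausdorffMeasure_real,
      Real.volume_Ioo, ENNReal.toReal_ofReal]
    · ring
    · nlinarith
  rw [Jl, hvol, hper]
  ring

lemma Jl_hp {lam d φ α β : ℝ} (hd : 0 < d) (hα0 : -Real.pi ≤ α) (hβ0 : β ≤ Real.pi)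
    (hα : -(Real.pi / 2) < α - φ) (hαβ : α ≤ β) (hβ : β - φ < Real.pi / 2) :
    Jl lam (hp d φ) α β
      = (lam * d ^ 2 / 2 - d) * (Real.tan (β - φ) - Real.tan (α - φ)) := by
  have hπ := Real.pi_pos
  have h := Jl_rot (lam := lam) (s := φ) (α := α - φ) (β := β - φ) (by linarith) (by linarith)
    (by linarith) (by linarith) (hp d 0)
  rwa [rot_hp, zero_add, sub_add_cancel, sub_add_cancel,
    Jl_hp_zero hd hα (by linarith) hβ] at h

/-! ### Kinds of boundary elements -/

/-- The admissible central angles. -/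
def adm (a b : ℝ) : Set ℝ := {η | 0 < η ∧ η < Real.pi / 2 ∧ a ≤ b * Real.cos η}

/-- A kind of boundary elements with endpoints on the circle of radius `ρ`: the element with
central direction `φ` and central angle `η` bounds `K φ η` in the sector of directions
`(φ - η, φ + η)`, and each half of this sector contributes `F η` to `J`. -/
structure IsKind (a b lam ρ : ℝ) (K : ℝ → ℝ → Set ℂ) (F : ℝ → ℝ) : Prop where
  le_radius : a ≤ ρ
  radius_le : ρ ≤ b
  convex : ∀ φ η, Convex ℝ (K φ η)
  zero_mem : ∀ φ, ∀ η ∈ adm a b, 0 ∈ K φ η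
  left_mem : ∀ φ, ∀ η ∈ adm a b, pol ρ (φ - η) ∈ K φ η
  right_mem : ∀ φ, ∀ η ∈ adm a b, pol ρ (φ + η) ∈ K φ η
  tangent : ∀ φ, ∀ η ∈ adm a b, ∀ ψ ∈ Ioo (φ - η) (φ + η), ∀ r > 0, pol r ψ ∈ K φ η →
    pol r ψ ∈ hp ρ (φ - η) ∧ pol r ψ ∈ hp ρ (φ + η)
  inner : ∀ φ, ∀ η ∈ adm a b, ∀ ψ ∈ Ioo (φ - η) (φ + η), ∀ r > 0, r ≤ a → pol r ψ ∈ K φ η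
  outer : ∀ φ, ∀ η ∈ adm a b, ∀ ψ ∈ Ioo (φ - η) (φ + η), ∀ r > 0, pol r ψ ∈ K φ η → r ≤ b
  shift : ∀ s φ η r ψ, pol r (ψ + s) ∈ K (φ + s) η ↔ pol r ψ ∈ K φ η
  radius_ne : ∀ φ, ∀ η ∈ adm a b, ∀ ψ ∈ Ioo (φ - η) (φ + η),
    ¬ (pol ρ ψ ∈ K φ η ∧ ∀ r > ρ, pol r ψ ∉ K φ η)
  Jl_left : ∀ φ, ∀ η ∈ adm a b, -Real.pi ≤ φ - η → φ ≤ Real.pi →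
    Jl lam (K φ η) (φ - η) φ = F η
  Jl_right : ∀ φ, ∀ η ∈ adm a b, -Real.pi ≤ φ → φ + η ≤ Real.pi →
    Jl lam (K φ η) φ (φ + η) = F η

lemma cos_lt_cos_sub {φ η ψ : ℝ} (hη : η < Real.pi / 2) (hψ : ψ ∈ Ioo (φ - η) (φ + η)) :
    Real.cos η < Real.cos (ψ - φ) := by
  have hπ := Real.pi_pos
  rw [← Real.cos_abs (ψ - φ)]
  refine Real.cos_lt_cos_of_nonneg_of_le_pi (abs_nonneg _) (by linarith) ?_
  rw [abs_lt]
  exact ⟨by linarith [hψ.1], by linarith [hψ.2]⟩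

/-- The contribution of half a chord of `D_b`. -/
def chordF (b lam η : ℝ) : ℝ :=
  (lam * (b * Real.cos η) ^ 2 / 2 - b * Real.cos η) * Real.tan η

/-- The contribution of half a tangent side to `D_a`. -/
def sideF (a lam η : ℝ) : ℝ := (lam * a ^ 2 / 2 - a) * Real.tan η

lemma isKind_chord {a b : ℝ} (ha : 0 < a) (hab : a < b) (lam : ℝ) :
    IsKind a b lam b (fun φ η => hp (b * Real.cos η) φ) (chordF b lam) := by
  have hb : 0 < b := ha.trans hab
  have hπ := Real.pi_pos
  have outer : ∀ φ, ∀ η ∈ adm a b, ∀ ψ ∈ Ioo (φ - η) (φ + η), ∀ r > 0,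
      pol r ψ ∈ hp (b * Real.cos η) φ → r ≤ b := by
    rintro φ η ⟨h0, h1, h2⟩ ψ hψ r hr h
    rw [pol_mem_hp] at h
    have hc : 0 < Real.cos η := Real.cos_pos_of_mem_Ioo ⟨by linarith, h1⟩
    have := mul_le_mul_of_nonneg_left (cos_lt_cos_sub h1 hψ).le hr.le
    exact le_of_mul_le_mul_right (this.trans h) hc
  refine ⟨hab.le, le_rfl, fun φ η => convex_hp _ _, ?_, ?_, ?_, ?_, ?_, outer, ?_, ?_, ?_, ?_⟩
  · rintro φ η ⟨h0, h1, h2⟩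
    exact zero_mem_hp (ha.le.trans h2)
  · rintro φ η -
    rw [pol_mem_hp, sub_sub_cancel_left, Real.cos_neg]
  · rintro φ η -
    rw [pol_mem_hp, add_sub_cancel_left]
  · intro φ η hη ψ hψ r hr h
    have hrb := outer φ η hη ψ hψ r hr h
    exact ⟨disc_subset_hp le_rfl ((pol_mem_disc hr.le).2 hrb),
      disc_subset_hp le_rfl ((pol_mem_disc hr.le).2 hrb)⟩
  · intro φ η hη ψ hψ r hr h
    exact disc_subset_hp hη.2.2 ((pol_mem_disc hr.le).2 h)
  · intro s φ η r ψ
    simp only [pol_mem_hp, add_sub_add_right_eq_sub]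
  · rintro φ η ⟨h0, h1, h2⟩ ψ hψ ⟨h, -⟩
    rw [pol_mem_hp] at h
    exact absurd (le_of_mul_le_mul_left h hb) (not_le.2 (cos_lt_cos_sub h1 hψ))
  · rintro φ η ⟨h0, h1, h2⟩ h3 h4
    rw [Jl_hp (ha.trans_le h2) h3 h4 (by linarith) (by linarith) (by linarith), chordF,
      sub_self, Real.tan_zero, sub_sub_cancel_left, Real.tan_neg]
    ring
  · rintro φ η ⟨h0, h1, h2⟩ h3 h4
    rw [Jl_hp (ha.trans_le h2) h3 h4 (by linarith) (by linarith) (by linarith), chordF,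
      sub_self, Real.tan_zero, add_sub_cancel_left]
    ring

lemma cos_add_le_cos_sub {φ η ψ : ℝ} (h1 : η < Real.pi / 2) (hψ : ψ ∈ Ioc (φ - η) φ) :
    Real.cos (ψ - (φ + η)) ≤ Real.cos (ψ - (φ - η)) ∧ Real.cos η ≤ Real.cos (ψ - (φ - η)) := by
  have hπ := Real.pi_pos
  obtain ⟨h3, h4⟩ := hψ
  constructor
  · rw [← Real.cos_neg (ψ - (φ + η))]
    exact Real.cos_le_cos_of_nonneg_of_le_pi (by linarith) (by linarith) (by linarith)
  · exact Real.cos_le_cos_of_nonneg_of_le_pi (by linarith) (by linarith) (by linarith)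

lemma cos_sub_le_cos_add {φ η ψ : ℝ} (h1 : η < Real.pi / 2) (hψ : ψ ∈ Ico φ (φ + η)) :
    Real.cos (ψ - (φ - η)) ≤ Real.cos (ψ - (φ + η)) ∧ Real.cos η ≤ Real.cos (ψ - (φ + η)) := by
  have hπ := Real.pi_pos
  obtain ⟨h3, h4⟩ := hψ
  rw [← Real.cos_neg (ψ - (φ + η))]
  constructor
  · exact Real.cos_le_cos_of_nonneg_of_le_pi (by linarith) (by linarith) (by linarith)
  · exact Real.cos_le_cos_of_nonneg_of_le_pi (by linarith) (by linarith) (by linarith)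

lemma mem_side_left {a φ η ψ r : ℝ} (h1 : η < Real.pi / 2) (hr : 0 < r)
    (hψ : ψ ∈ Ioc (φ - η) φ) :
    pol r ψ ∈ hp a (φ - η) ∩ hp a (φ + η) ↔ r * Real.cos (ψ - (φ - η)) ≤ a := by
  rw [mem_inter_iff, pol_mem_hp, pol_mem_hp]
  exact ⟨fun h => h.1, fun h => ⟨h, (mul_le_mul_of_nonneg_left
    (cos_add_le_cos_sub h1 hψ).1 hr.le).trans h⟩⟩

lemma mem_side_right {a φ η ψ r : ℝ} (h1 : η < Real.pi / 2) (hr : 0 < r)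
    (hψ : ψ ∈ Ico φ (φ + η)) :
    pol r ψ ∈ hp a (φ - η) ∩ hp a (φ + η) ↔ r * Real.cos (ψ - (φ + η)) ≤ a := by
  rw [mem_inter_iff, pol_mem_hp, pol_mem_hp]
  exact ⟨fun h => h.2, fun h => ⟨(mul_le_mul_of_nonneg_left
    (cos_sub_le_cos_add h1 hψ).1 hr.le).trans h, h⟩⟩

lemma isKind_side {a b : ℝ} (ha : 0 < a) (hab : a < b) (lam : ℝ) :
    IsKind a b lam a (fun φ η => hp a (φ - η) ∩ hp a (φ + η)) (sideF a lam) := by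
  have hb : 0 < b := ha.trans hab
  have hπ := Real.pi_pos
  refine ⟨le_rfl, hab.le, fun φ η => (convex_hp _ _).inter (convex_hp _ _), ?_, ?_, ?_, ?_, ?_,
    ?_, ?_, ?_, ?_, ?_⟩
  · exact fun φ η _ => ⟨zero_mem_hp ha.le, zero_mem_hp ha.le⟩
  · exact fun φ η _ => ⟨disc_subset_hp le_rfl ((pol_mem_disc ha.le).2 le_rfl),
      disc_subset_hp le_rfl ((pol_mem_disc ha.le).2 le_rfl)⟩
  · exact fun φ η _ => ⟨disc_subset_hp le_rfl ((pol_mem_disc ha.le).2 le_rfl),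
      disc_subset_hp le_rfl ((pol_mem_disc ha.le).2 le_rfl)⟩
  · exact fun φ η _ ψ _ r _ h => h
  · exact fun φ η _ ψ _ r hr h => ⟨disc_subset_hp le_rfl ((pol_mem_disc hr.le).2 h),
      disc_subset_hp le_rfl ((pol_mem_disc hr.le).2 h)⟩
  · rintro φ η ⟨h0, h1, h2⟩ ψ hψ r hr h
    have hc : 0 < Real.cos η := Real.cos_pos_of_mem_Ioo ⟨by linarith, h1⟩
    have key : r * Real.cos η ≤ a := by
      rcases le_total ψ φ with h' | h'
      · rw [mem_side_left h1 hr ⟨hψ.1, h'⟩] at h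
        exact (mul_le_mul_of_nonneg_left (cos_add_le_cos_sub h1 ⟨hψ.1, h'⟩).2 hr.le).trans h
      · rw [mem_side_right h1 hr ⟨h', hψ.2⟩] at h
        exact (mul_le_mul_of_nonneg_left (cos_sub_le_cos_add h1 ⟨h', hψ.2⟩).2 hr.le).trans h
    exact le_of_mul_le_mul_right (key.trans h2) hc
  · intro s φ η r ψ
    simp only [mem_inter_iff, pol_mem_hp]
    ring_nf
  · rintro φ η ⟨h0, h1, h2⟩ ψ hψ ⟨-, h⟩
    -- In direction ψ the side is reached at a radius beyond a, because both cosines are below 1.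
    -- The term 1/2 only makes positivity of c immediate.
    set c := max (max (Real.cos (ψ - (φ - η))) (Real.cos (ψ - (φ + η)))) (1 / 2) with hc
    have lt1 : ∀ x, 0 < x → x < Real.pi → Real.cos x < 1 := fun x hx hx' => by
      rw [← Real.cos_zero]
      exact Real.cos_lt_cos_of_nonneg_of_le_pi le_rfl hx'.le hx
    have hc1 : c < 1 := by
      refine max_lt (max_lt ?_ ?_) (by norm_num)
      · exact lt1 _ (by linarith [hψ.1]) (by linarith [hψ.2])
      · rw [← Real.cos_neg]
        exact lt1 _ (by linarith [hψ.2]) (by linarith [hψ.1])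
    have hc0 : 0 < c := lt_of_lt_of_le (by norm_num) (le_max_right _ _)
    have hac : 0 < a / c := by positivity
    refine h (a / c) ((lt_div_iff₀ hc0).2 (by nlinarith)) ⟨?_, ?_⟩
    · rw [pol_mem_hp]
      calc _ ≤ a / c * c := mul_le_mul_of_nonneg_left
            ((le_max_left _ _).trans (le_max_left _ _)) hac.le
        _ = a := div_mul_cancel₀ _ hc0.ne'
    · rw [pol_mem_hp]
      calc _ ≤ a / c * c := mul_le_mul_of_nonneg_left
            ((le_max_right _ _).trans (le_max_left _ _)) hac.le
        _ = a := div_mul_cancel₀ _ hc0.ne'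
  · rintro φ η ⟨h0, h1, h2⟩ h3 h4
    rw [Jl_congr h4 (Ω' := hp a (φ - η)), Jl_hp ha h3 h4 (by linarith) (by linarith)
      (by linarith), sub_self, Real.tan_zero, sub_sub_cancel, sideF, sub_zero]
    ext z
    refine and_congr_left fun hz => ?_
    obtain ⟨r, ψ, hr, hψ, rfl⟩ := exists_pol_of_mem_sec hz
    rw [mem_side_left h1 hr ⟨hψ.1, hψ.2.le⟩, pol_mem_hp]
  · rintro φ η ⟨h0, h1, h2⟩ h3 h4
    rw [Jl_congr h4 (Ω' := hp a (φ + η)), Jl_hp ha h3 h4 (by linarith) (by linarith)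
      (by linarith), sub_self, Real.tan_zero, sub_add_cancel_left, sideF, Real.tan_neg,
      zero_sub, neg_neg]
    ext z
    refine and_congr_left fun hz => ?_
    obtain ⟨r, ψ, hr, hψ, rfl⟩ := exists_pol_of_mem_sec hz
    rw [mem_side_right h1 hr ⟨hψ.1.le, hψ.2⟩, pol_mem_hp]

/-! ### Elements of a set -/

/-- In the sector of directions `(φ - η, φ + η)`, the set `E` is bounded by the element of kind
`K` with central direction `φ` and central angle `η`. -/
structure IsElem (a b ρ : ℝ) (K : ℝ → ℝ → Set ℂ) (E : Set ℂ) (φ η : ℝ) : Prop where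
  adm : η ∈ adm a b
  left_mem : pol ρ (φ - η) ∈ E
  right_mem : pol ρ (φ + η) ∈ E
  left_hp : E ⊆ hp ρ (φ - η)
  right_hp : E ⊆ hp ρ (φ + η)
  iff : ∀ ψ ∈ Ioo (φ - η) (φ + η), ∀ r > 0, pol r ψ ∈ E ↔ pol r ψ ∈ K φ η

lemma IsElem.rot {a b lam ρ : ℝ} {K : ℝ → ℝ → Set ℂ} {F : ℝ → ℝ} (hk : IsKind a b lam ρ K F)
    {E : Set ℂ} {φ η : ℝ} (h : IsElem a b ρ K E φ η) (s : ℝ) :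
    IsElem a b ρ K (rot s '' E) (φ + s) η := by
  refine ⟨h.adm, ?_, ?_, ?_, ?_, ?_⟩
  · rw [pol_mem_rot, show φ + s - η - s = φ - η by ring]
    exact h.left_mem
  · rw [pol_mem_rot, show φ + s + η - s = φ + η by ring]
    exact h.right_mem
  · rw [show φ + s - η = φ - η + s by ring, ← rot_hp]
    exact image_mono h.left_hp
  · rw [show φ + s + η = φ + η + s by ring, ← rot_hp]
    exact image_mono h.right_hp
  · intro ψ hψ r hr
    rw [pol_mem_rot, h.iff (ψ - s) ⟨by linarith [hψ.1], by linarith [hψ.2]⟩ r hr,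
      ← hk.shift s, sub_add_cancel]

lemma IsElem.add_int {a b lam ρ : ℝ} {K : ℝ → ℝ → Set ℂ} {F : ℝ → ℝ}
    (hk : IsKind a b lam ρ K F) {E : Set ℂ} {φ η : ℝ} (h : IsElem a b ρ K E φ η) (k : ℤ) :
    IsElem a b ρ K E (φ + k * (2 * Real.pi)) η := by
  have := h.rot hk (k * (2 * Real.pi))
  have e : AnnulusProblem.rot (k * (2 * Real.pi)) '' E = E := by
    ext z
    rw [← pol_arg z, pol_mem_rot, ← pol_add_int _ _ k, sub_add_cancel]
  rwa [e] at this

/-- The end points of an element are not in the open sector of another element. -/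
lemma IsElem.not_mem {a b lam ρ : ℝ} {K : ℝ → ℝ → Set ℂ} {F : ℝ → ℝ}
    (hρ : 0 < ρ) (hk : IsKind a b lam ρ K F) {E : Set ℂ} {φ η ψ : ℝ}
    (h : IsElem a b ρ K E φ η) (hψ : pol ρ ψ ∈ E) (hψ' : E ⊆ hp ρ ψ) :
    ψ ∉ Ioo (φ - η) (φ + η) := by
  intro hmem
  -- The tangent at ψ would make the boundary radius in direction ψ exactly ρ, whereas strictly
  -- inside its sector a chord stays below b and a side stays above a.
  refine hk.radius_ne φ η h.adm ψ hmem ⟨(h.iff ψ hmem ρ hρ).1 hψ, fun r hr hrK => ?_⟩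
  have := hψ' ((h.iff ψ hmem r (hρ.trans hr)).2 hrK)
  rw [pol_mem_hp, sub_self, Real.cos_zero, mul_one] at this
  exact absurd this (not_le.2 hr)

/-! ### From segments to elements -/

lemma eq_pol_of_proj {z : ℂ} {r φ η : ℝ} (hz : ‖z‖ = r)
    (h : z.re * Real.cos φ + z.im * Real.sin φ = r * Real.cos η) :
    z = pol r (φ - η) ∨ z = pol r (φ + η) := by
  have hn : z.re ^ 2 + z.im ^ 2 = r ^ 2 := by
    rw [← hz, Complex.sq_norm, Complex.normSq_apply]
    ring
  have h1 := Real.sin_sq_add_cos_sq φ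
  have h2 := Real.sin_sq_add_cos_sq η
  set q := z.im * Real.cos φ - z.re * Real.sin φ with hq
  have hsq : q ^ 2 = (r * Real.sin η) ^ 2 := by
    have e : (z.re * Real.cos φ + z.im * Real.sin φ) ^ 2 + q ^ 2
        = (z.re ^ 2 + z.im ^ 2) * (Real.sin φ ^ 2 + Real.cos φ ^ 2) := by
      rw [hq]; ring
    rw [h, h1, hn] at e
    nlinarith
  have hre : z.re = (r * Real.cos η) * Real.cos φ - q * Real.sin φ := by
    rw [← h, hq]
    linear_combination (-z.re) * h1
  have him : z.im = (r * Real.cos η) * Real.sin φ + q * Real.cos φ := by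
    rw [← h, hq]
    linear_combination (-z.im) * h1
  rcases sq_eq_sq_iff_eq_or_eq_neg.1 hsq with h' | h'
  · right
    apply Complex.ext
    · rw [hre, h', pol_re, Real.cos_add]; ring
    · rw [him, h', pol_im, Real.sin_add]; ring
  · left
    apply Complex.ext
    · rw [hre, h', pol_re, Real.cos_sub]; ring
    · rw [him, h', pol_im, Real.sin_sub]; ring

/-- Points of the line at distance d from the origin with normal direction φ are affine in the
tangent of their angle, and tan is monotone. -/
lemma pol_mem_segment {d φ t t₁ t₂ : ℝ} (h1 : -(Real.pi / 2) < t₁) (h2 : t₂ < Real.pi / 2)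
    (ht1 : t₁ ≤ t) (ht2 : t ≤ t₂) :
    pol (d / Real.cos t) (φ + t) ∈
      segment ℝ (pol (d / Real.cos t₁) (φ + t₁)) (pol (d / Real.cos t₂) (φ + t₂)) := by
  have hf : ∀ s, -(Real.pi / 2) < s → s < Real.pi / 2 →
      pol (d / Real.cos s) (φ + s) = AffineMap.lineMap (pol d φ)
        (pol d φ + pol d (φ + Real.pi / 2)) (Real.tan s) := by
    intro s hs hs'
    have hc : Real.cos s ≠ 0 := (Real.cos_pos_of_mem_Ioo ⟨hs, hs'⟩).ne'
    rw [AffineMap.lineMap_apply, vsub_eq_sub, add_sub_cancel_left, vadd_eq_add, smul_pol,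
      Real.tan_eq_sin_div_cos]
    apply Complex.ext
    · simp only [pol_re, Complex.add_re, Real.cos_add, Real.cos_pi_div_two, Real.sin_pi_div_two]
      field_simp
      ring
    · simp only [pol_im, Complex.add_im, Real.sin_add, Real.cos_pi_div_two, Real.sin_pi_div_two]
      field_simp
      ring
  have hm : ∀ s s', -(Real.pi / 2) < s → s' < Real.pi / 2 → s ≤ s' →
      Real.tan s ≤ Real.tan s' := fun s s' hs hs' h =>
    Real.strictMonoOn_tan.monotoneOn ⟨hs, by linarith⟩ ⟨by linarith, hs'⟩ h
  rw [hf t (by linarith) (by linarith), hf t₁ h1 (by linarith), hf t₂ (by linarith) h2,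
    ← image_segment]
  refine mem_image_of_mem _ ?_
  rw [segment_eq_Icc (hm t₁ t₂ h1 h2 (by linarith))]
  exact ⟨hm t₁ t h1 (by linarith) ht1, hm t t₂ (by linarith) h2 ht2⟩

lemma pol_mem_iff_of_frontier {a b : ℝ} (ha : 0 < a) {E : Set ℂ} (hE : E ∈ classC a b)
    (hEc : IsClosed E) {R ψ : ℝ} (hR : 0 < R) (h : pol R ψ ∈ frontier E) {r : ℝ} (hr : 0 < r) :
    pol r ψ ∈ E ↔ r ≤ R := by
  constructor
  · intro hrE
    by_contra! hlt
    exact not_mem_frontier_of_lt ha hE hR.le hlt (subset_closure hrE) h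
  · intro hle
    have h0 : (0 : ℂ) ∈ E := interior_subset (zero_mem_interior ha hE)
    have := hE.1.smul_mem_of_zero_mem h0 (hEc.frontier_subset h) (t := r / R)
      ⟨by positivity, (div_le_one hR).2 hle⟩
    rwa [smul_pol, div_mul_cancel₀ _ hR.ne'] at this

/-- If z in E were beyond the tangent at T, then prolonging the segment from z past T would enter
the open disc of radius a. T would lie strictly between a point of E and an interior point, hence be
interior. -/
lemma subset_hp_of_mem_frontier {a b : ℝ} (ha : 0 < a) {E : Set ℂ} (hE : E ∈ classC a b)
    {τ : ℝ} (h : pol a τ ∈ frontier E) : E ⊆ hp a τ := by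
  intro z hz
  by_contra hlt
  rw [mem_hp, not_le] at hlt
  set T := pol a τ with hT
  set k := z.re * Real.cos τ + z.im * Real.sin τ - a with hk
  have hk0 : 0 < k := by linarith
  have hzT : z ≠ T := by
    rintro rfl
    have : k = 0 := by
      rw [hk, hT, pol_re, pol_im]
      linear_combination a * Real.sin_sq_add_cos_sq τ
    exact hk0.ne' this
  have hN : 0 < ‖z - T‖ ^ 2 := by
    have := norm_pos_iff.2 (sub_ne_zero.2 hzT)
    positivity
  set N := ‖z - T‖ ^ 2 with hNdef
  -- This ε minimizes ‖T - ε(z - T)‖² = a² - 2εak + ε²N.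
  set ε := a * k / N with hε
  have hε0 : 0 < ε := by positivity
  have hw : T - ε • (z - T) ∈ interior E := by
    refine interior_maximal (Metric.ball_subset_closedBall.trans hE.2.1) Metric.isOpen_ball ?_
    rw [mem_ball_zero_iff]
    refine lt_of_pow_lt_pow_left₀ 2 ha.le ?_
    have e1 : N = (z.re - a * Real.cos τ) ^ 2 + (z.im - a * Real.sin τ) ^ 2 := by
      rw [hNdef, Complex.sq_norm, Complex.normSq_apply, hT]
      simp
      ring
    have e2 : ‖T - ε • (z - T)‖ ^ 2 = a ^ 2 - 2 * ε * (a * k) + ε ^ 2 * N := by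
      rw [Complex.sq_norm, Complex.normSq_apply, e1, hk, hT]
      simp
      linear_combination (a ^ 2 + 2 * ε * a ^ 2) * Real.sin_sq_add_cos_sq τ
    have e3 : ε * N = a * k := div_mul_cancel₀ _ hN.ne'
    rw [e2]
    have e4 : ε ^ 2 * N = ε * (a * k) := by rw [pow_two, mul_assoc, e3]
    rw [e4]
    have : 0 < ε * (a * k) := by positivity
    linarith
  refine h.2 (hE.1.openSegment_interior_self_subset_interior hw hz ?_)
  refine ⟨1 / (1 + ε), ε / (1 + ε), by positivity, by positivity, by field_simp, ?_⟩
  have h1 : (1 + ε) ≠ 0 := by positivity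
  have : (1 + ε) • ((1 / (1 + ε)) • (T - ε • (z - T)) + (ε / (1 + ε)) • z) = (1 + ε) • T := by
    rw [smul_add, smul_smul, smul_smul, mul_one_div_cancel h1, mul_div_cancel₀ _ h1, one_smul,
      smul_sub, add_smul, one_smul]
    abel
  exact smul_right_injective ℂ h1 this

/-- The chord of `D_b` with central direction `φ` and central angle `η`. -/
def chordSet (b φ η : ℝ) : Set ℂ := segment ℝ (pol b (φ - η)) (pol b (φ + η))

/-- The tangent side to `D_a` with central direction `φ` and central angle `η`. -/
def sideSet (a φ η : ℝ) : Set ℂ :=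
  segment ℝ (pol a (φ - η)) (pol (a / Real.cos η) φ) ∪
    segment ℝ (pol (a / Real.cos η) φ) (pol a (φ + η))

/-- E is star-shaped about 0, so one boundary point in each direction determines E there; in
direction ψ the chord is at radius b cos η / cos(ψ - φ). -/
lemma isElem_chord {a b φ η : ℝ} (ha : 0 < a) (hab : a < b) {E : Set ℂ} (hE : E ∈ classC a b)
    (hEc : IsClosed E) (hη : η ∈ adm a b) (h : chordSet b φ η ⊆ frontier E) :
    IsElem a b b (fun φ η => hp (b * Real.cos η) φ) E φ η := by
  obtain ⟨h0, h1, h2⟩ := hη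
  have hb : 0 < b := ha.trans hab
  have hπ := Real.pi_pos
  have hc : 0 < Real.cos η := Real.cos_pos_of_mem_Ioo ⟨by linarith, h1⟩
  have hd : E ⊆ disc b := hE.2.2
  refine ⟨⟨h0, h1, h2⟩, hEc.frontier_subset (h (left_mem_segment ℝ _ _)),
    hEc.frontier_subset (h (right_mem_segment ℝ _ _)), hd.trans (disc_subset_hp le_rfl),
    hd.trans (disc_subset_hp le_rfl), ?_⟩
  intro ψ hψ r hr
  have hc' := hc.trans (cos_lt_cos_sub h1 hψ)
  have hm := pol_mem_segment (d := b * Real.cos η) (φ := φ) (t := ψ - φ) (t₁ := -η) (t₂ := η)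
    (by linarith) h1 (by linarith [hψ.1]) (by linarith [hψ.2])
  rw [Real.cos_neg, mul_div_cancel_right₀ _ hc.ne', add_sub_cancel, ← sub_eq_add_neg] at hm
  rw [pol_mem_iff_of_frontier ha hE hEc (by positivity) (h hm) hr, pol_mem_hp,
    le_div_iff₀ hc']

lemma isElem_side {a b φ η : ℝ} (ha : 0 < a) {E : Set ℂ} (hE : E ∈ classC a b)
    (hEc : IsClosed E) (hη : η ∈ adm a b) (h : sideSet a φ η ⊆ frontier E) :
    IsElem a b a (fun φ η => hp a (φ - η) ∩ hp a (φ + η)) E φ η := by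
  obtain ⟨h0, h1, h2⟩ := hη
  have hπ := Real.pi_pos
  have hc : 0 < Real.cos η := Real.cos_pos_of_mem_Ioo ⟨by linarith, h1⟩
  have hl := h (Or.inl (left_mem_segment ℝ _ _))
  have hr := h (Or.inr (right_mem_segment ℝ _ _))
  refine ⟨⟨h0, h1, h2⟩, hEc.frontier_subset hl, hEc.frontier_subset hr,
    subset_hp_of_mem_frontier ha hE hl, subset_hp_of_mem_frontier ha hE hr, ?_⟩
  intro ψ hψ r hr
  rcases le_total ψ φ with h' | h'
  · have hc' := hc.trans_le (cos_add_le_cos_sub h1 ⟨hψ.1, h'⟩).2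
    have hm := pol_mem_segment (d := a) (φ := φ - η) (t := ψ - (φ - η)) (t₁ := 0) (t₂ := η)
      (by linarith) h1 (by linarith [hψ.1]) (by linarith)
    rw [Real.cos_zero, div_one, add_sub_cancel, add_zero, sub_add_cancel] at hm
    rw [pol_mem_iff_of_frontier ha hE hEc (by positivity) (h (Or.inl hm)) hr,
      mem_side_left h1 hr ⟨hψ.1, h'⟩, le_div_iff₀ hc']
  · have hc' := hc.trans_le (cos_sub_le_cos_add h1 ⟨h', hψ.2⟩).2
    have hm := pol_mem_segment (d := a) (φ := φ + η) (t := ψ - (φ + η)) (t₁ := -η) (t₂ := 0)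
      (by linarith) (by linarith) (by linarith) (by linarith [hψ.2])
    rw [Real.cos_zero, div_one, add_sub_cancel, add_zero, add_neg_cancel_right,
      Real.cos_neg] at hm
    rw [pol_mem_iff_of_frontier ha hE hEc (by positivity) (h (Or.inr hm)) hr,
      mem_side_right h1 hr ⟨h', hψ.2⟩, le_div_iff₀ hc']

lemma inner_pol_right (z : ℂ) (r φ : ℝ) :
    inner ℝ z (pol r φ) = r * (z.re * Real.cos φ + z.im * Real.sin φ) := by
  simp [Complex.inner]
  ring

/-- Two distinct points of equal norm with the same projection on direction φ are mirror images in
that axis. This covers both the ends of a chord and the two points of tangency of a side. -/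
lemma angle_pos_lt_of_proj {r R φ η : ℝ} {z w : ℂ} (hr : 0 < r) (hR : 0 < R) (hzw : z ≠ w)
    (hz : ‖z‖ = r) (hw : ‖w‖ = r)
    (hη : InnerProductGeometry.angle z (pol R φ) = η) (hpos : 0 < inner ℝ z (pol R φ))
    (heq : inner ℝ w (pol R φ) = inner ℝ z (pol R φ)) :
    0 < η ∧ η < Real.pi / 2 ∧ inner ℝ z (pol R φ) = r * R * Real.cos η ∧
      ((z = pol r (φ - η) ∧ w = pol r (φ + η)) ∨
        (w = pol r (φ - η) ∧ z = pol r (φ + η))) := by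
  have hcos := InnerProductGeometry.cos_angle_mul_norm_mul_norm z (pol R φ)
  rw [hη, hz, norm_pol, abs_of_pos hR] at hcos
  have hin : inner ℝ z (pol R φ) = r * R * Real.cos η := by rw [← hcos]; ring
  have hpz : z.re * Real.cos φ + z.im * Real.sin φ = r * Real.cos η := by
    rw [inner_pol_right] at hin
    exact mul_left_cancel₀ hR.ne' (hin.trans (by ring))
  have hpw : w.re * Real.cos φ + w.im * Real.sin φ = r * Real.cos η := by
    rw [hin, inner_pol_right] at heq
    exact mul_left_cancel₀ hR.ne' (heq.trans (by ring))
  have hη0 : 0 ≤ η := hη ▸ InnerProductGeometry.angle_nonneg _ _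
  have hηπ : η ≤ Real.pi := hη ▸ InnerProductGeometry.angle_le_pi _ _
  have hlt : η < Real.pi / 2 := by
    by_contra! h
    have := Real.cos_nonpos_of_pi_div_two_le_of_le h (by linarith [Real.pi_pos])
    have : r * R * Real.cos η ≤ 0 := mul_nonpos_of_nonneg_of_nonpos (by positivity) this
    linarith
  have h1 := eq_pol_of_proj hz hpz
  have h2 := eq_pol_of_proj hw hpw
  have hne : η ≠ 0 := by
    rintro rfl
    simp only [sub_zero, add_zero, or_self] at h1 h2
    exact hzw (h1.trans h2.symm)
  refine ⟨lt_of_le_of_ne hη0 hne.symm, hlt, hin, ?_⟩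
  rcases h1 with h1 | h1 <;> rcases h2 with h2 | h2
  · exact absurd (h1.trans h2.symm) hzw
  · exact Or.inl ⟨h1, h2⟩
  · exact Or.inr ⟨h2, h1⟩
  · exact absurd (h1.trans h2.symm) hzw

lemma IsChord.exists_eq {a b η : ℝ} (ha : 0 < a) (hab : a < b) {S : Set ℂ}
    (h : IsChord a b η S) :
    (0 < η ∧ η < Real.pi / 2 ∧ a < b * Real.cos η) ∧ ∃ φ, S = chordSet b φ η := by
  obtain ⟨P, P', hne, hP, hP', hM, rfl, hη⟩ := h
  have hb : 0 < b := ha.trans hab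
  set M := midpoint ℝ P P' with hMdef
  have hR : 0 < ‖M‖ := ha.trans hM
  have hMP : M = (1 / 2 : ℝ) • (P + P') := by
    rw [hMdef, midpoint_eq_smul_add]
    norm_num
  have hMM : inner ℝ M M = ‖M‖ ^ 2 := real_inner_self_eq_norm_sq M
  have hPP : inner ℝ P P = b ^ 2 := by rw [real_inner_self_eq_norm_sq, hP]
  have hPP' : inner ℝ P' P' = b ^ 2 := by rw [real_inner_self_eq_norm_sq, hP']
  have hin : inner ℝ P M = ‖M‖ ^ 2 := by
    rw [← hMM, hMP]
    simp only [inner_smul_left, inner_smul_right, inner_add_left, inner_add_right, hPP, hPP',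
      real_inner_comm P P', conj_trivial]
    ring
  have hin' : inner ℝ P' M = inner ℝ P M := by
    rw [hMP]
    simp only [inner_smul_right, inner_add_right, hPP, hPP', real_inner_comm P P']
    ring
  have hMpol : pol ‖M‖ M.arg = M := pol_arg M
  obtain ⟨h0, h1, h2, h3⟩ := angle_pos_lt_of_proj (φ := M.arg) (η := η) hb hR hne hP hP'
    (by rwa [hMpol]) (by rw [hMpol, hin]; positivity) (by rwa [hMpol])
  rw [hMpol, hin] at h2
  have h4 : ‖M‖ = b * Real.cos η :=
    mul_left_cancel₀ hR.ne' (by linear_combination h2)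
  refine ⟨⟨h0, h1, h4 ▸ hM⟩, M.arg, ?_⟩
  rcases h3 with ⟨h3, h5⟩ | ⟨h3, h5⟩
  · rw [chordSet, ← h3, ← h5]
  · rw [chordSet, ← h3, ← h5, segment_symm]

lemma IsTangentSide.exists_eq {a b θ : ℝ} (ha : 0 < a) {S : Set ℂ}
    (h : IsTangentSide a b θ S) :
    (0 < θ ∧ θ < Real.pi / 2 ∧ a < b * Real.cos θ) ∧ ∃ φ, S = sideSet a φ θ := by
  obtain ⟨T, Q, T', hne, ⟨hT, hTQ⟩, ⟨hT', hTQ'⟩, hQ, rfl, hθ⟩ := h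
  have hin : inner ℝ T Q = a ^ 2 := by
    rw [inner_sub_right, real_inner_self_eq_norm_sq, hT] at hTQ
    linarith
  have hin' : inner ℝ T' Q = a ^ 2 := by
    rw [inner_sub_right, real_inner_self_eq_norm_sq, hT'] at hTQ'
    linarith
  have hR : 0 < ‖Q‖ := by
    rw [norm_pos_iff]
    rintro rfl
    rw [inner_zero_right] at hin
    have : 0 < a ^ 2 := by positivity
    linarith
  have hQpol : pol ‖Q‖ Q.arg = Q := pol_arg Q
  obtain ⟨h0, h1, h2, h3⟩ := angle_pos_lt_of_proj (φ := Q.arg) (η := θ) ha hR hne hT hT'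
    (by rwa [hQpol]) (by rw [hQpol, hin]; positivity) (by rw [hQpol, hin, hin'])
  rw [hQpol, hin] at h2
  have hc : 0 < Real.cos θ := Real.cos_pos_of_mem_Ioo ⟨by linarith [Real.pi_pos], h1⟩
  have h4 : a = ‖Q‖ * Real.cos θ :=
    mul_left_cancel₀ ha.ne' (by linear_combination h2)
  have h5 : ‖Q‖ = a / Real.cos θ := by
    rw [eq_div_iff hc.ne', ← h4]
  rw [h5] at hQpol
  refine ⟨⟨h0, h1, ?_⟩, Q.arg, ?_⟩
  · calc a = ‖Q‖ * Real.cos θ := h4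
      _ < b * Real.cos θ := mul_lt_mul_of_pos_right hQ hc
  · rcases h3 with ⟨h3, h6⟩ | ⟨h3, h6⟩
    · rw [sideSet, ← h3, ← h6, hQpol]
    · rw [sideSet, ← h3, ← h6, hQpol, union_comm, segment_symm ℝ T' Q, segment_symm ℝ T Q]

/-! ### Exchange of angles -/

section

variable {a b lam ρ : ℝ} {K : ℝ → ℝ → Set ℂ} {F : ℝ → ℝ}

lemma IsKind.Jl_eq (hk : IsKind a b lam ρ K F) (ha : 0 < a) (hab : a < b) {Ω : Set ℂ}
    (hΩ : Ω ∈ classC a b) {φ η : ℝ} (hη : η ∈ adm a b) (hl : -Real.pi ≤ φ - η)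
    (hr : φ + η ≤ Real.pi)
    (h : Ω ∩ sec (φ - η) (φ + η) = K φ η ∩ sec (φ - η) (φ + η)) :
    Jl lam Ω (φ - η) (φ + η) = 2 * F η := by
  have h0 := hη.1
  have hsub : ∀ α β, φ - η ≤ α → β ≤ φ + η → Ω ∩ sec α β = K φ η ∩ sec α β := by
    intro α β hα hβ
    have : sec α β = sec (φ - η) (φ + η) ∩ sec α β := by
      rw [eq_comm, inter_eq_right]
      exact fun z hz => ⟨hz.1, hα.trans_lt hz.2.1, hz.2.2.trans_le hβ⟩
    rw [this, ← inter_assoc, ← inter_assoc, h]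
  rw [Jl_add ha hab hΩ (β := φ) (by linarith) (by linarith) hr,
    Jl_congr (by linarith) (hsub (φ - η) φ le_rfl (by linarith)),
    Jl_congr hr (hsub φ (φ + η) (by linarith) le_rfl),
    hk.Jl_left φ η hη hl (by linarith), hk.Jl_right φ η hη (by linarith) hr]
  ring

lemma IsElem.inter_sec {E : Set ℂ} {φ η : ℝ} (h : IsElem a b ρ K E φ η) :
    E ∩ sec (φ - η) (φ + η) = K φ η ∩ sec (φ - η) (φ + η) := by
  ext z
  refine and_congr_left fun hz => ?_
  obtain ⟨r, ψ, hr, hψ, rfl⟩ := exists_pol_of_mem_sec hz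
  exact h.iff ψ hψ r hr

/-- The normalization puts the start of the first element at -π, the cut of `Complex.arg`. The new
set has four sectors: the enlarged first element, the intermediate part rotated by 2t, the reduced
second element, and the unchanged remainder. -/
lemma exchange_of_le (hk : IsKind a b lam ρ K F) (ha : 0 < a) (hab : a < b) {E : Set ℂ}
    (hE : E ∈ classC a b) {φ₁ φ₂ x y t : ℝ} (e₁ : IsElem a b ρ K E φ₁ x)
    (e₂ : IsElem a b ρ K E φ₂ y) (h1 : φ₁ - x = -Real.pi) (h2 : φ₁ + x ≤ φ₂ - y)
    (h3 : φ₂ + y ≤ Real.pi) (hx : x + t ∈ adm a b) (hy : y - t ∈ adm a b) :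
    ∃ E' ∈ classC a b, J lam E' = J lam E + 2 * (F (x + t) + F (y - t) - F x - F y) := by
  have hx0 := hx.1
  have hy0 := hy.1
  have hx1 := e₁.adm.1
  have hy1 := e₂.adm.1
  set v : ℕ → ℝ := fun i => match i with
    | 0 => φ₁ + t - (x + t)
    | 1 => φ₁ + t + (x + t)
    | 2 => φ₂ + t - (y - t)
    | 3 => φ₂ + t + (y - t)
    | _ => Real.pi with hv
  set G : ℕ → Set ℂ := fun i => match i with
    | 0 => K (φ₁ + t) (x + t)
    | 1 => rot (2 * t) '' E
    | 2 => K (φ₂ + t) (y - t)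
    | _ => E with hG
  have hmono : Monotone v := by
    refine monotone_nat_of_le_succ fun i => ?_
    rcases i with _ | _ | _ | _ | i
    · change φ₁ + t - (x + t) ≤ φ₁ + t + (x + t); linarith
    · change φ₁ + t + (x + t) ≤ φ₂ + t - (y - t); linarith
    · change φ₂ + t - (y - t) ≤ φ₂ + t + (y - t); linarith
    · change φ₂ + t + (y - t) ≤ Real.pi; linarith
    · exact le_rfl
  have hRE := rot_mem_classC (s := 2 * t) hE
  have r₁ := e₁.rot hk (2 * t)
  have r₂ := e₂.rot hk (2 * t)
  have c1 : φ₁ + 2 * t + x = φ₁ + t + (x + t) := by ring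
  have c2 : φ₂ + 2 * t - y = φ₂ + t - (y - t) := by ring
  have c3 : φ₂ + y = φ₂ + t + (y - t) := by ring
  have c4 : φ₁ - x = φ₁ + t - (x + t) := by ring
  have m₁ := r₁.right_mem
  have m₂ := r₂.left_mem
  have m₃ := e₂.right_mem
  have p₁ := r₁.right_hp
  have p₂ := r₂.left_hp
  have p₃ := e₂.right_hp
  rw [c1] at m₁ p₁
  rw [c2] at m₂ p₂
  rw [c3] at m₃ p₃
  -- The last sector ends at π, which is the same direction as the start -π of the first element.
  have hπl : pol ρ Real.pi ∈ E := by
    rw [show Real.pi = φ₁ - x + 2 * Real.pi by rw [h1]; ring, pol_add_two_pi]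
    exact e₁.left_mem
  have hπhp : E ⊆ hp ρ Real.pi := by
    rw [show Real.pi = φ₁ - x + 2 * Real.pi by rw [h1]; ring, hp_add_two_pi]
    exact e₁.left_hp
  have h0E : (0 : ℂ) ∈ E := interior_subset (zero_mem_interior ha hE)
  have h0R : (0 : ℂ) ∈ rot (2 * t) '' E := interior_subset (zero_mem_interior ha hRE)
  obtain ⟨Ω, hΩ, hs⟩ := exists_glue (ha.le.trans hk.le_radius) hk.le_radius hk.radius_le 4 v
    hmono (c4.symm.trans h1) rfl G
    (by
      intro i hi
      interval_cases i
      · exact hk.convex _ _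
      · exact hRE.1
      · exact hk.convex _ _
      · exact hE.1)
    (by
      intro i hi
      interval_cases i
      · exact hk.zero_mem _ _ hx
      · exact h0R
      · exact hk.zero_mem _ _ hy
      · exact h0E)
    (by
      intro i hi
      interval_cases i
      · exact hk.left_mem _ _ hx
      · exact m₁
      · exact hk.left_mem _ _ hy
      · exact m₃)
    (by
      intro i hi
      interval_cases i
      · exact hk.right_mem _ _ hx
      · exact m₂
      · exact hk.right_mem _ _ hy
      · exact hπl)
    (by
      intro i hi z hz hzs
      interval_cases i
      · obtain ⟨r, ψ, hr, hψ, rfl⟩ := exists_pol_of_mem_sec hzs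
        exact hk.tangent _ _ hx ψ hψ r hr hz
      · exact ⟨p₁ hz, p₂ hz⟩
      · obtain ⟨r, ψ, hr, hψ, rfl⟩ := exists_pol_of_mem_sec hzs
        exact hk.tangent _ _ hy ψ hψ r hr hz
      · exact ⟨p₃ hz, hπhp hz⟩)
    (by
      intro i hi z hz hzs
      interval_cases i
      · obtain ⟨r, ψ, hr, hψ, rfl⟩ := exists_pol_of_mem_sec hzs
        exact hk.inner _ _ hx ψ hψ r hr ((pol_mem_disc hr.le).1 hz)
      · exact hRE.2.1 hz
      · obtain ⟨r, ψ, hr, hψ, rfl⟩ := exists_pol_of_mem_sec hzs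
        exact hk.inner _ _ hy ψ hψ r hr ((pol_mem_disc hr.le).1 hz)
      · exact hE.2.1 hz)
    (by
      intro i hi z hz hzs
      interval_cases i
      · obtain ⟨r, ψ, hr, hψ, rfl⟩ := exists_pol_of_mem_sec hzs
        exact (pol_mem_disc hr.le).2 (hk.outer _ _ hx ψ hψ r hr hz)
      · exact hRE.2.2 hz
      · obtain ⟨r, ψ, hr, hψ, rfl⟩ := exists_pol_of_mem_sec hzs
        exact (pol_mem_disc hr.le).2 (hk.outer _ _ hy ψ hψ r hr hz)
      · exact hE.2.2 hz)
  refine ⟨Ω, hΩ, ?_⟩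
  have s0 : Jl lam Ω (φ₁ + t - (x + t)) (φ₁ + t + (x + t)) = 2 * F (x + t) :=
    hk.Jl_eq ha hab hΩ hx (by linarith) (by linarith) (hs 0 (by norm_num))
  have s1 : Jl lam Ω (φ₁ + t + (x + t)) (φ₂ + t - (y - t)) =
      Jl lam (rot (2 * t) '' E) (φ₁ + t + (x + t)) (φ₂ + t - (y - t)) :=
    Jl_congr (by linarith) (hs 1 (by norm_num))
  have s2 : Jl lam Ω (φ₂ + t - (y - t)) (φ₂ + t + (y - t)) = 2 * F (y - t) :=
    hk.Jl_eq ha hab hΩ hy (by linarith) (by linarith) (hs 2 (by norm_num))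
  have s3 : Jl lam Ω (φ₂ + t + (y - t)) Real.pi = Jl lam E (φ₂ + t + (y - t)) Real.pi :=
    Jl_congr le_rfl (hs 3 (by norm_num))
  have u0 := hk.Jl_eq ha hab hE e₁.adm (by linarith) (by linarith) e₁.inter_sec
  have u2 := hk.Jl_eq ha hab hE e₂.adm (by linarith) (by linarith) e₂.inter_sec
  have u1 : Jl lam (rot (2 * t) '' E) (φ₁ + t + (x + t)) (φ₂ + t - (y - t)) =
      Jl lam E (φ₁ + x) (φ₂ - y) := by
    rw [← Jl_rot (s := 2 * t) (α := φ₁ + x) (by linarith) (by linarith) (by linarith)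
      (by linarith)]
    congr 1 <;> ring
  rw [J_eq_Jl ha hΩ, J_eq_Jl ha hE, ← h1,
    Jl_add ha hab hE (β := φ₁ + x) (by linarith) (by linarith) le_rfl,
    Jl_add ha hab hE (α := φ₁ + x) (β := φ₂ - y) (by linarith) (by linarith) le_rfl,
    Jl_add ha hab hE (α := φ₂ - y) (β := φ₂ + y) (by linarith) (by linarith) le_rfl, u0, u2, c4,
    Jl_add ha hab hΩ (β := φ₁ + t + (x + t)) (by linarith) (by linarith) le_rfl,
    Jl_add ha hab hΩ (α := φ₁ + t + (x + t)) (β := φ₂ + t - (y - t)) (by linarith)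
      (by linarith) le_rfl,
    Jl_add ha hab hΩ (α := φ₂ + t - (y - t)) (β := φ₂ + t + (y - t)) (by linarith)
      (by linarith) le_rfl, s0, s1, s2, s3, u1, ← c3]
  ring

/-- Two distinct elements of the same kind can exchange a part of their central angles. -/
theorem exchange (hk : IsKind a b lam ρ K F) (ha : 0 < a) (hab : a < b) {E : Set ℂ}
    (hE : E ∈ classC a b) {φ₁ φ₂ x y t : ℝ} (e₁ : IsElem a b ρ K E φ₁ x)
    (e₂ : IsElem a b ρ K E φ₂ y) (hne : ∀ k : ℤ, x = y → φ₁ ≠ φ₂ + k * (2 * Real.pi))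
    (hx : x + t ∈ adm a b) (hy : y - t ∈ adm a b) :
    ∃ E' ∈ classC a b, J lam E' = J lam E + 2 * (F (x + t) + F (y - t) - F x - F y) := by
  have hρ : 0 < ρ := ha.trans_le hk.le_radius
  have hπ := Real.pi_pos
  set s := -Real.pi - (φ₁ - x) with hs
  obtain ⟨k, hk', -⟩ := existsUnique_add_zsmul_mem_Ico (mul_pos two_pos hπ) (φ₂ + s - y)
    (-Real.pi)
  rw [zsmul_eq_mul] at hk'
  obtain ⟨hk1, hk2⟩ := hk'
  have d₁ := e₁.rot hk s
  have d₂ := (e₂.rot hk s).add_int hk k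
  set ψ₁ := φ₁ + s with hψ₁
  set ψ₂ := φ₂ + s + k * (2 * Real.pi) with hψ₂
  have g1 : ψ₁ - x = -Real.pi := by rw [hψ₁, hs]; ring
  have hx1 := e₁.adm.1
  have hy1 := e₂.adm.1
  have n1 := d₁.not_mem hρ hk d₂.left_mem d₂.left_hp
  have n2 := d₁.not_mem hρ hk d₂.right_mem d₂.right_hp
  have n3 := d₂.not_mem hρ hk d₁.right_mem d₁.right_hp
  have n4 := d₂.not_mem hρ hk (ψ := ψ₁ - x + 2 * Real.pi)
    (by rw [pol_add_two_pi]; exact d₁.left_mem) (by rw [hp_add_two_pi]; exact d₁.left_hp)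
  rw [mem_Ioo, not_and_or, not_lt, not_lt] at n1 n2 n3 n4
  have g3 : ψ₂ + y ≤ Real.pi := by
    rcases n4 with h | h <;> linarith
  -- If the second element started inside or before the first, both would start at -π; as neither
  -- contains an end of the other, they would coincide modulo 2π.
  have g2 : ψ₁ + x ≤ ψ₂ - y := by
    rcases n1 with h | h
    · exfalso
      have e : ψ₂ - y = -Real.pi := by linarith
      have e' : x = y := by
        rcases n2 with h' | h' <;> rcases n3 with h'' | h'' <;> linarith
      refine hne k e' ?_
      have : ψ₁ = ψ₂ := by linarith
      rw [hψ₁, hψ₂] at this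
      linarith
    · exact h
  obtain ⟨E', hE', hJ⟩ := exchange_of_le hk ha hab (rot_mem_classC hE) d₁ d₂ g1 g2 g3 hx hy
  exact ⟨E', hE', by rw [hJ, J_rot]⟩

/-- A tangent side can be replaced by two tangent sides of half its central angle. -/
theorem split_side (ha : 0 < a) (hab : a < b) (lam : ℝ) {E : Set ℂ}
    (hE : E ∈ classC a b) {φ x : ℝ}
    (e : IsElem a b a (fun φ η => hp a (φ - η) ∩ hp a (φ + η)) E φ x) :
    ∃ E' ∈ classC a b, J lam E' = J lam E + (4 * sideF a lam (x / 2) - 2 * sideF a lam x) := by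
  have hk := isKind_side ha hab lam
  set s := -Real.pi - (φ - x) with hs
  have d := e.rot hk s
  set ψ := φ + s with hψ
  have g1 : ψ - x = -Real.pi := by rw [hψ, hs]; ring
  rw [← J_rot lam s E]
  have hE := rot_mem_classC (s := s) hE
  set D := rot s '' E with hD
  obtain ⟨hx0, hx1, hx2⟩ := d.adm
  have hπ := Real.pi_pos
  have hx : x / 2 ∈ adm a b := by
    refine ⟨by linarith, by linarith, hx2.trans ?_⟩
    refine mul_le_mul_of_nonneg_left ?_ (ha.trans hab).le
    exact Real.cos_le_cos_of_nonneg_of_le_pi (by linarith) (by linarith) (by linarith)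
  -- The new tangent touches the circle in the central direction of the side and cuts off its
  -- corner, leaving two sides of half the angle.
  set ω := D ∩ hp a ψ with hω
  have hΩ : ω ∈ classC a b :=
    ⟨hE.1.inter (convex_hp _ _), subset_inter hE.2.1 (disc_subset_hp le_rfl),
      inter_subset_left.trans hE.2.2⟩
  have c1 : ψ - x / 2 - x / 2 = ψ - x := by ring
  have c2 : ψ - x / 2 + x / 2 = ψ := by ring
  have c3 : ψ + x / 2 - x / 2 = ψ := by ring
  have c4 : ψ + x / 2 + x / 2 = ψ + x := by ring
  have s0 := hk.Jl_eq ha hab hΩ (φ := ψ - x / 2) hx (by linarith) (by linarith) (by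
    ext z
    refine and_congr_left fun hz => ?_
    obtain ⟨r, τ, hr, hτ, rfl⟩ := exists_pol_of_mem_sec hz
    rw [c1, c2] at hτ ⊢
    rw [hω, mem_inter_iff, d.iff τ ⟨hτ.1, by linarith [hτ.2]⟩ r hr,
      mem_side_left hx1 hr ⟨hτ.1, hτ.2.le⟩, mem_inter_iff, pol_mem_hp, pol_mem_hp])
  have s1 := hk.Jl_eq ha hab hΩ (φ := ψ + x / 2) hx (by linarith) (by linarith) (by
    ext z
    refine and_congr_left fun hz => ?_
    obtain ⟨r, τ, hr, hτ, rfl⟩ := exists_pol_of_mem_sec hz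
    rw [c3, c4] at hτ ⊢
    rw [hω, mem_inter_iff, d.iff τ ⟨by linarith [hτ.1], hτ.2⟩ r hr,
      mem_side_right hx1 hr ⟨hτ.1.le, hτ.2⟩, mem_inter_iff, pol_mem_hp, pol_mem_hp, and_comm])
  -- Outside the sector of the side, the new half-plane is implied by the tangents at ψ - x and ψ +
  -- x.
  have s2 : Jl lam ω (ψ + x) Real.pi = Jl lam D (ψ + x) Real.pi := by
    refine Jl_congr le_rfl ?_
    ext z
    refine and_congr_left fun hz => ⟨fun h => h.1, fun h => ⟨h, ?_⟩⟩
    obtain ⟨r, τ, hr, hτ, rfl⟩ := exists_pol_of_mem_sec hz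
    have hl := d.left_hp h
    have hr' := d.right_hp h
    rw [← hp_add_two_pi, pol_mem_hp, g1] at hl
    rw [pol_mem_hp] at hr' ⊢
    refine mul_cos_sub_le hr.le (by linarith) le_rfl ⟨hτ.1.le, hτ.2.le⟩
      ⟨by linarith, by linarith⟩ (fun hτ' => by linarith [hτ'.1]) hr' ?_
    rwa [show -Real.pi + 2 * Real.pi = Real.pi by ring] at hl
  have u0 := hk.Jl_eq ha hab hE d.adm (by linarith) (by linarith) d.inter_sec
  rw [c1, c2] at s0
  rw [c3, c4] at s1
  refine ⟨ω, hΩ, ?_⟩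
  rw [J_eq_Jl ha hΩ, J_eq_Jl ha hE, ← g1,
    Jl_add ha hab hE (β := ψ + x) (by linarith) (by linarith) le_rfl, u0,
    Jl_add ha hab hΩ (β := ψ + x) (by linarith) (by linarith) le_rfl,
    Jl_add ha hab hΩ (α := ψ - x) (β := ψ) (by linarith) (by linarith) (by linarith),
    s0, s1, s2]
  ring


end

/-! ### Closed optimal sets -/

lemma closure_mem_classC {a b : ℝ} {Ω : Set ℂ} (h : Ω ∈ classC a b) :
    closure Ω ∈ classC a b :=
  ⟨h.1.closure, h.2.1.trans subset_closure,
    closure_minimal h.2.2 Metric.isClosed_closedBall⟩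

lemma frontier_closure_eq {a b : ℝ} (ha : 0 < a) {Ω : Set ℂ} (h : Ω ∈ classC a b) :
    frontier (closure Ω) = frontier Ω := by
  rw [frontier, frontier, closure_closure,
    h.1.interior_closure_eq_interior_of_nonempty_interior ⟨0, zero_mem_interior ha h⟩]

lemma J_closure {a b : ℝ} (ha : 0 < a) (lam : ℝ) {Ω : Set ℂ} (h : Ω ∈ classC a b) :
    J lam (closure Ω) = J lam Ω := by
  unfold J perimeter
  rw [frontier_closure_eq ha h, measure_congr (closure_ae_eq_of_null_frontier
    (h.1.addHaar_frontier volume))]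

/-! ### Small changes of angles -/

lemma exists_adm_nhds {a b x y : ℝ} (hx : 0 < x ∧ x < Real.pi / 2 ∧ a < b * Real.cos x)
    (hy : 0 < y ∧ y < Real.pi / 2 ∧ a < b * Real.cos y) :
    ∀ᶠ t in nhds (0 : ℝ), x + t ∈ adm a b ∧ y - t ∈ adm a b := by
  have key : ∀ z, (0 < z ∧ z < Real.pi / 2 ∧ a < b * Real.cos z) → ∀ f : ℝ → ℝ,
      Continuous f → f 0 = z → ∀ᶠ t in nhds (0 : ℝ), f t ∈ adm a b := by
    rintro z ⟨h1, h2, h3⟩ f hf rfl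
    filter_upwards [hf.continuousAt.eventually_const_lt h1,
      hf.continuousAt.eventually_lt_const h2,
      (continuous_const.mul (Real.continuous_cos.comp hf)).continuousAt.eventually_const_lt h3]
      with t h1 h2 h3
    exact ⟨h1, h2, h3.le⟩
  exact (key x hx (fun t => x + t) (by fun_prop) (by simp)).and
    (key y hy (fun t => y - t) (by fun_prop) (by simp))

lemma two_mul_tan_half_lt {x : ℝ} (h0 : 0 < x) (h1 : x < Real.pi / 2) :
    2 * Real.tan (x / 2) < Real.tan x := by
  have ht : 0 < Real.tan (x / 2) :=
    Real.tan_pos_of_pos_of_lt_pi_div_two (by linarith) (by linarith)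
  have ht1 : Real.tan (x / 2) < 1 := by
    rw [← Real.tan_pi_div_four]
    exact Real.tan_lt_tan_of_lt_of_lt_pi_div_two (by linarith) (by linarith [Real.pi_pos])
      (by linarith)
  have e : Real.tan x = 2 * Real.tan (x / 2) / (1 - Real.tan (x / 2) ^ 2) := by
    rw [← Real.tan_two_mul]
    ring_nf
  have hpos : 0 < 1 - Real.tan (x / 2) ^ 2 := by nlinarith
  rw [e, lt_div_iff₀ hpos]
  nlinarith [mul_pos ht (pow_pos ht 2)]

/-- The sum of tangents is sin(x + y)/(cos x cos y), and 2 cos x cos y = cos(x + y) + cos(x - y).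
With the sum fixed, spreading the angles apart decreases only the denominator. -/
lemma tan_add_tan_lt {x y t : ℝ} (hyx : y ≤ x) (ht : 0 < t) (hy : 0 < y - t)
    (hx : x + t < Real.pi / 2) :
    Real.tan x + Real.tan y < Real.tan (x + t) + Real.tan (y - t) := by
  have hπ := Real.pi_pos
  have c : ∀ z, 0 < z → z < Real.pi / 2 → 0 < Real.cos z := fun z h h' =>
    Real.cos_pos_of_mem_Ioo ⟨by linarith, h'⟩
  have c1 := c x (by linarith) (by linarith)
  have c2 := c y (by linarith) (by linarith)
  have c3 := c (x + t) (by linarith) (by linarith)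
  have c4 := c (y - t) (by linarith) (by linarith)
  have hs : 0 < Real.sin (x + y) := Real.sin_pos_of_pos_of_lt_pi (by linarith) (by linarith)
  have e1 : Real.tan x + Real.tan y = Real.sin (x + y) / (Real.cos x * Real.cos y) := by
    rw [Real.tan_eq_sin_div_cos, Real.tan_eq_sin_div_cos, Real.sin_add]
    field_simp
  have e2 : Real.tan (x + t) + Real.tan (y - t)
      = Real.sin (x + y) / (Real.cos (x + t) * Real.cos (y - t)) := by
    rw [show x + y = (x + t) + (y - t) by ring, Real.sin_add (x + t) (y - t),
      Real.tan_eq_sin_div_cos, Real.tan_eq_sin_div_cos]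
    field_simp
  rw [e1, e2]
  refine div_lt_div_of_pos_left hs (by positivity) ?_
  have p : ∀ u v, Real.cos (u + v) + Real.cos (u - v) = 2 * (Real.cos u * Real.cos v) :=
    fun u v => by rw [Real.cos_add, Real.cos_sub]; ring
  have p1 := p x y
  have p2 := p (x + t) (y - t)
  rw [show x + t + (y - t) = x + y by ring] at p2
  have : Real.cos (x + t - (y - t)) < Real.cos (x - y) :=
    Real.cos_lt_cos_of_nonneg_of_le_pi (by linarith) (by linarith) (by linarith)
  linarith

/-- At δ = 0 the first factor is negative for small t ≠ 0, so the second cannot be positive near 0.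
For δ ≠ 0 the product vanishes at t = 0, which is therefore a local minimum; its derivative there is
-sin δ (2m cos δ - 1), with sin δ ≠ 0. -/
lemma local_min_cos {δ m : ℝ} (hδ : |δ| < Real.pi)
    (h : ∀ᶠ t in nhds (0 : ℝ), 0 ≤ (Real.cos (δ + t) - Real.cos δ) *
      (m * (Real.cos (δ + t) + Real.cos δ) - 1)) :
    (δ = 0 → 2 * m ≤ 1) ∧ (δ ≠ 0 → 2 * m * Real.cos δ = 1) := by
  constructor
  · rintro rfl
    by_contra! hm
    have hcont : Continuous fun t : ℝ => m * (Real.cos (0 + t) + Real.cos 0) - 1 := by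
      fun_prop
    have hpos := (hcont.continuousAt (x := 0)).eventually_const_lt (u := 0)
      (by simp only [add_zero, Real.cos_zero]; linarith)
    obtain ⟨ε, hε, hb⟩ := Metric.eventually_nhds_iff.1 (h.and hpos)
    have hπ := Real.pi_pos
    -- The cap π keeps t where cos is strictly decreasing.
    set t := min (ε / 2) Real.pi with ht
    have ht0 : 0 < t := lt_min (by linarith) hπ
    obtain ⟨h1, h2⟩ := hb (y := t) (by
      rw [dist_zero_right, Real.norm_eq_abs, abs_of_pos ht0]
      exact (min_le_left _ _).trans_lt (by linarith))
    have h3 : Real.cos (0 + t) < Real.cos 0 :=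
      Real.cos_lt_cos_of_nonneg_of_le_pi le_rfl (by rw [zero_add]; exact min_le_right _ _)
        (by linarith)
    exact absurd h1 (not_le.2 (mul_neg_of_neg_of_pos (sub_neg.2 h3) h2))
  · intro h0
    set f : ℝ → ℝ := fun t => (Real.cos (δ + t) - Real.cos δ) *
      (m * (Real.cos (δ + t) + Real.cos δ) - 1) with hf
    have hmin : IsLocalMin f 0 := by
      filter_upwards [h] with t ht
      simpa [hf] using ht
    have hc : HasDerivAt (fun t => Real.cos (δ + t)) (-Real.sin δ) 0 := by
      have := (Real.hasDerivAt_cos (δ + 0)).comp_const_add δ 0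
      simpa using this
    have hd := (hc.sub_const (Real.cos δ)).mul (((hc.add_const (Real.cos δ)).const_mul m).sub_const 1)
    have hz := hmin.hasDerivAt_eq_zero hd
    simp only [add_zero, sub_self, zero_mul] at hz
    have hs : Real.sin δ ≠ 0 := by
      rw [abs_lt] at hδ
      exact (Real.sin_eq_zero_iff_of_lt_of_lt hδ.1 hδ.2).not.2 h0
    have : Real.sin δ * (2 * m * Real.cos δ - 1) = 0 := by linear_combination -hz
    have := (mul_eq_zero.1 this).resolve_left hs
    linarith

lemma chordF_add {b lam x y : ℝ} (hx : Real.cos x ≠ 0) (hy : Real.cos y ≠ 0) :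
    chordF b lam x + chordF b lam y = b * Real.sin ((x + y) / 2) *
      (lam * b * Real.cos ((x + y) / 2) * (2 * Real.cos ((x - y) / 2) ^ 2 - 1)
        - 2 * Real.cos ((x - y) / 2)) := by
  have e : ∀ z, Real.cos z ≠ 0 →
      chordF b lam z = lam * b ^ 2 / 2 * (Real.sin z * Real.cos z) - b * Real.sin z := by
    intro z hz
    rw [chordF, Real.tan_eq_sin_div_cos]
    field_simp
  rw [e x hx, e y hy]
  set s := (x + y) / 2
  set d := (x - y) / 2
  have hx : x = s + d := by ring
  have hy : y = s - d := by ring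
  rw [hx, hy, Real.sin_add, Real.sin_sub, Real.cos_add, Real.cos_sub]
  linear_combination (lam * b ^ 2 * Real.sin s * Real.cos s) * (-Real.sin_sq_add_cos_sq d)

/-! ### Elements of optimal sets -/

section

variable {a b lam : ℝ} {E : Set ℂ}

lemma side_unique (ha : 0 < a) (hab : a < b) (hE : E ∈ classC a b) (hEc : IsClosed E)
    (hopt : ∀ K ∈ classC a b, J lam E ≤ J lam K) (hlam : lam ≠ 2 / a) {θ₁ θ₂ : ℝ}
    {S₁ S₂ : Set ℂ} (h₁ : IsTangentSide a b θ₁ S₁) (hS₁ : S₁ ⊆ frontier E)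
    (h₂ : IsTangentSide a b θ₂ S₂) (hS₂ : S₂ ⊆ frontier E) : θ₁ = θ₂ ∧ S₁ = S₂ := by
  have hk := isKind_side ha hab lam
  by_contra hne
  wlog hle : θ₂ ≤ θ₁ generalizing θ₁ θ₂ S₁ S₂
  · exact this h₂ hS₂ h₁ hS₁ (fun h => hne ⟨h.1.symm, h.2.symm⟩) (le_of_not_ge hle)
  obtain ⟨hθ₁, φ₁, rfl⟩ := h₁.exists_eq ha
  obtain ⟨hθ₂, φ₂, rfl⟩ := h₂.exists_eq ha
  have e₁ := isElem_side ha hE hEc ⟨hθ₁.1, hθ₁.2.1, hθ₁.2.2.le⟩ hS₁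
  have e₂ := isElem_side ha hE hEc ⟨hθ₂.1, hθ₂.2.1, hθ₂.2.2.le⟩ hS₂
  rcases lt_or_gt_of_ne hlam with hl | hl
  · have hc : lam * a ^ 2 / 2 - a < 0 := by
      rw [lt_div_iff₀ ha] at hl
      nlinarith
    obtain ⟨ε, hε, hb⟩ := Metric.eventually_nhds_iff.1 (exists_adm_nhds hθ₁ hθ₂)
    obtain ⟨ht1, ht2⟩ := hb (y := ε / 2) (by
      rw [dist_zero_right, Real.norm_eq_abs, abs_of_pos (by linarith)]
      linarith)
    obtain ⟨E', hE', hJ⟩ := exchange hk ha hab hE e₁ e₂ (by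
      rintro k rfl rfl
      refine hne ⟨rfl, ?_⟩
      rw [sideSet, sideSet, pol_add_int, add_sub_right_comm, add_right_comm, pol_add_int,
        pol_add_int]) ht1 ht2
    have hlt := tan_add_tan_lt hle (half_pos hε) ht2.1 ht1.2.1
    have := hopt E' hE'
    rw [hJ] at this
    simp only [sideF] at this
    nlinarith
  -- Here a single side already contradicts optimality.
  · have hc : 0 < lam * a ^ 2 / 2 - a := by
      rw [div_lt_iff₀ ha] at hl
      nlinarith
    obtain ⟨E', hE', hJ⟩ := split_side ha hab lam hE e₁
    have := hopt E' hE'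
    rw [hJ] at this
    have hlt := two_mul_tan_half_lt hθ₁.1 hθ₁.2.1
    simp only [sideF] at this
    nlinarith

lemma chord_pair (ha : 0 < a) (hab : a < b) (hE : E ∈ classC a b) (hEc : IsClosed E)
    (hopt : ∀ K ∈ classC a b, J lam E ≤ J lam K) {x y : ℝ}
    {S₁ S₂ : Set ℂ} (h₁ : IsChord a b x S₁) (hS₁ : S₁ ⊆ frontier E)
    (h₂ : IsChord a b y S₂) (hS₂ : S₂ ⊆ frontier E) (hne : ¬(x = y ∧ S₁ = S₂)) :
    (x = y → 2 * (lam * b * Real.cos x) ≤ 1) ∧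
      (x ≠ y → lam * b * (Real.cos x + Real.cos y) = 1) := by
  have hk := isKind_chord ha hab lam
  have hb : 0 < b := ha.trans hab
  obtain ⟨hx, φ₁, rfl⟩ := h₁.exists_eq ha hab
  obtain ⟨hy, φ₂, rfl⟩ := h₂.exists_eq ha hab
  have e₁ := isElem_chord ha hab hE hEc ⟨hx.1, hx.2.1, hx.2.2.le⟩ hS₁
  have e₂ := isElem_chord ha hab hE hEc ⟨hy.1, hy.2.1, hy.2.2.le⟩ hS₂
  have hcos : ∀ z ∈ adm a b, Real.cos z ≠ 0 := fun z hz =>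
    (Real.cos_pos_of_mem_Ioo ⟨by linarith [hz.1, Real.pi_pos], hz.2.1⟩).ne'
  set s := (x + y) / 2 with hs
  set δ := (x - y) / 2 with hδ
  have hsin : 0 < Real.sin s :=
    Real.sin_pos_of_pos_of_lt_pi (by linarith [hx.1, hy.1]) (by linarith [hx.2.1, hy.2.1])
  have hev : ∀ᶠ t in nhds (0 : ℝ), 0 ≤ (Real.cos (δ + t) - Real.cos δ) *
      (lam * b * Real.cos s * (Real.cos (δ + t) + Real.cos δ) - 1) := by
    filter_upwards [exists_adm_nhds hx hy] with t ht
    obtain ⟨E', hE', hJ⟩ := exchange hk ha hab hE e₁ e₂ (by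
      rintro k rfl rfl
      refine hne ⟨rfl, ?_⟩
      rw [chordSet, chordSet, add_sub_right_comm, add_right_comm, pol_add_int,
        pol_add_int]) ht.1 ht.2
    have h := hopt E' hE'
    rw [hJ] at h
    have h1 := chordF_add (b := b) (lam := lam) (hcos _ e₁.adm) (hcos _ e₂.adm)
    have h2 := chordF_add (b := b) (lam := lam) (hcos _ ht.1) (hcos _ ht.2)
    rw [show (x + t + (y - t)) / 2 = s by ring, show (x + t - (y - t)) / 2 = δ + t by ring] at h2
    rw [← hs, ← hδ] at h1
    -- The change of `chordF_add` from δ to δ + t is a difference of two values of a quadratic in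
    -- the cosine, so cos(δ + t) - cos δ factors out.
    have h3 : 0 ≤ (2 * (b * Real.sin s)) * ((Real.cos (δ + t) - Real.cos δ) *
        (lam * b * Real.cos s * (Real.cos (δ + t) + Real.cos δ) - 1)) := by
      linear_combination h / 2 + h2 - h1
    exact nonneg_of_mul_nonneg_right h3 (by positivity)
  have := local_min_cos (by
    rw [abs_lt]
    constructor <;> linarith [hx.1, hx.2.1, hy.1, hy.2.1, Real.pi_pos]) hev
  constructor
  · rintro rfl
    have h := this.1 (by rw [hδ]; ring)
    rwa [show s = x by rw [hs]; ring] at h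
  · intro hxy
    have h := this.2 (fun h0 => hxy (by rw [hδ] at h0; linarith))
    rw [← h, show x = s + δ by rw [hs, hδ]; ring, show y = s - δ by rw [hs, hδ]; ring,
      Real.cos_add, Real.cos_sub]
    ring

lemma finite_chords (ha : 0 < a) (hab : a < b) (hE : E ∈ classC a b) (hEc : IsClosed E)
    (η : ℝ) : {S | IsChord a b η S ∧ S ⊆ frontier E}.Finite := by
  -- Only the geometry of chords is used, so any value of λ would do.
  have hk := isKind_chord ha hab 0
  have hb : 0 < b := ha.trans hab
  have hπ := Real.pi_pos
  set T := {φ | φ ∈ Ico (-Real.pi) (-Real.pi + 2 * Real.pi) ∧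
    IsElem a b b (fun φ η => hp (b * Real.cos η) φ) E φ η} with hT
  have hTf : T.Finite := by
    rcases T.eq_empty_or_nonempty with h | ⟨φ₀, h₀⟩
    · rw [h]
      exact finite_empty
    have hη : 0 < η := h₀.2.adm.1
    have hsep : ∀ φ ∈ T, ∀ φ' ∈ T, φ < φ' → φ' < φ + 2 * η → False := by
      intro φ hφ φ' hφ' h1 h2
      exact hφ.2.not_mem hb hk hφ'.2.left_mem hφ'.2.left_hp ⟨by linarith, by linarith⟩
    -- Central directions in [-π, π) of chords of angle η are at least 2η apart, so the integer part
    -- of φ/(2η) separates them, and it takes finitely many values.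
    refine Set.Finite.of_finite_image (f := fun φ => ⌊φ / (2 * η)⌋) ?_ ?_
    · refine (Set.finite_Icc ⌊-Real.pi / (2 * η)⌋ ⌊(-Real.pi + 2 * Real.pi) / (2 * η)⌋).subset ?_
      rintro _ ⟨φ, hφ, rfl⟩
      exact ⟨Int.floor_le_floor (by gcongr; exact hφ.1.1),
        Int.floor_le_floor (by gcongr; exact hφ.1.2.le)⟩
    · intro φ hφ φ' hφ' h
      have h1 := Int.abs_sub_lt_one_of_floor_eq_floor h
      rw [← sub_div, abs_div, abs_of_pos (by linarith : 0 < 2 * η), div_lt_one (by linarith),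
        abs_lt] at h1
      rcases lt_trichotomy φ φ' with h2 | h2 | h2
      · exact (hsep φ hφ φ' hφ' h2 (by linarith)).elim
      · exact h2
      · exact (hsep φ' hφ' φ hφ h2 (by linarith)).elim
  refine (hTf.image (fun φ => chordSet b φ η)).subset ?_
  rintro S ⟨hS, hSE⟩
  obtain ⟨hη, φ, rfl⟩ := hS.exists_eq ha hab
  have e := isElem_chord ha hab hE hEc ⟨hη.1, hη.2.1, hη.2.2.le⟩ hSE
  obtain ⟨k, hk', -⟩ := existsUnique_add_zsmul_mem_Ico (mul_pos two_pos hπ) φ (-Real.pi)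
  rw [zsmul_eq_mul] at hk'
  refine ⟨φ + k * (2 * Real.pi), ⟨hk', e.add_int hk k⟩, ?_⟩
  change chordSet b (φ + k * (2 * Real.pi)) η = chordSet b φ η
  rw [chordSet, chordSet, add_sub_right_comm, add_right_comm, pol_add_int, pol_add_int]

lemma anglesA_eq_copies (ha : 0 < a) (hab : a < b) (hE : E ∈ classC a b) (hEc : IsClosed E)
    (hopt : ∀ K ∈ classC a b, J lam E ≤ J lam K) (hlam : lam ≠ 2 / a) {θ : ℝ} {S : Set ℂ}
    (h : IsTangentSide a b θ S) (hS : S ⊆ frontier E) : anglesA a b E = copies 1 θ := by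
  funext θ'
  rcases eq_or_ne θ' θ with rfl | hne
  · have : {S' | IsTangentSide a b θ' S' ∧ S' ⊆ frontier E} = {S} := by
      refine Subset.antisymm (fun S' hS' => ?_) (by rintro _ rfl; exact ⟨h, hS⟩)
      exact (side_unique ha hab hE hEc hopt hlam hS'.1 hS'.2 h hS).2
    rw [anglesA, this, encard_singleton, copies, Pi.single_eq_same, Nat.cast_one]
  · have : {S' | IsTangentSide a b θ' S' ∧ S' ⊆ frontier E} = ∅ := by
      refine eq_empty_of_forall_notMem fun S' hS' => hne ?_
      exact (side_unique ha hab hE hEc hopt hlam hS'.1 hS'.2 h hS).1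
    rw [anglesA, this, encard_empty, copies, Pi.single_eq_of_ne hne]

lemma anglesB_ne_zero_iff {η : ℝ} :
    anglesB a b E η ≠ 0 ↔ ∃ S, IsChord a b η S ∧ S ⊆ frontier E := by
  rw [anglesB, encard_ne_zero]
  rfl

lemma exists_anglesB_eq (ha : 0 < a) (hab : a < b) (hE : E ∈ classC a b) (hEc : IsClosed E)
    {η : ℝ} (h : anglesB a b E η ≠ 0) :
    ∃ n : ℕ, 1 ≤ n ∧ anglesB a b E η = n := by
  have hfin := finite_chords ha hab hE hEc η
  refine ⟨_, ?_, hfin.encard_eq_coe_toFinset_card⟩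
  rw [Nat.one_le_iff_ne_zero]
  intro h0
  rw [anglesB, hfin.encard_eq_coe_toFinset_card, h0] at h
  exact h rfl

lemma anglesB_eq_copies (ha : 0 < a) (hab : a < b) (hE : E ∈ classC a b) (hEc : IsClosed E)
    (hopt : ∀ K ∈ classC a b, J lam E ≤ J lam K) (hne : anglesB a b E ≠ 0) :
    ∃ x ∈ Ioo 0 (Real.pi / 2), ∃ y ∈ Ioo 0 (Real.pi / 2), ∃ n : ℕ, 1 ≤ n ∧
      (anglesB a b E = copies n x ∨
        (anglesB a b E = copies n x + copies 1 y ∧ y < x ∧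
          Real.cos x + Real.cos y = 1 / (b * lam))) := by
  have hb : 0 < b := ha.trans hab
  have hIoo : ∀ η, anglesB a b E η ≠ 0 → η ∈ Ioo 0 (Real.pi / 2) := by
    intro η hη
    obtain ⟨S, hS, -⟩ := anglesB_ne_zero_iff.1 hη
    obtain ⟨h, -⟩ := hS.exists_eq ha hab
    exact ⟨h.1, h.2.1⟩
  have hpair : ∀ η η', anglesB a b E η ≠ 0 → anglesB a b E η' ≠ 0 → η ≠ η' →
      lam * b * (Real.cos η + Real.cos η') = 1 := by
    intro η η' hη hη' hne
    obtain ⟨S, hS, hSE⟩ := anglesB_ne_zero_iff.1 hη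
    obtain ⟨S', hS', hSE'⟩ := anglesB_ne_zero_iff.1 hη'
    exact (chord_pair ha hab hE hEc hopt hS hSE hS' hSE' fun h => hne h.1).2 hne
  obtain ⟨x₀, hx₀⟩ := Function.ne_iff.1 hne
  by_cases hone : ∀ z, anglesB a b E z ≠ 0 → z = x₀
  · obtain ⟨n, hn, hx⟩ := exists_anglesB_eq ha hab hE hEc hx₀
    refine ⟨x₀, hIoo x₀ hx₀, x₀, hIoo x₀ hx₀, n, hn, Or.inl ?_⟩
    funext z
    rcases eq_or_ne z x₀ with rfl | hz
    · rw [hx, copies, Pi.single_eq_same]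
    · rw [copies, Pi.single_eq_of_ne hz]
      by_contra h
      exact hz (hone z h)
  · have hex : ∃ x y, y < x ∧ anglesB a b E x ≠ 0 ∧ anglesB a b E y ≠ 0 := by
      push Not at hone
      obtain ⟨z, hz, hzx⟩ := hone
      rcases lt_or_gt_of_ne hzx with h | h
      · exact ⟨x₀, z, h, hx₀, hz⟩
      · exact ⟨z, x₀, h, hz, hx₀⟩
    obtain ⟨x, y, hyx, hx, hy⟩ := hex
    obtain ⟨n, hn, hxn⟩ := exists_anglesB_eq ha hab hE hEc hx
    have hxI := hIoo x hx
    have hyI := hIoo y hy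
    have hcos : Real.cos x < Real.cos y :=
      Real.cos_lt_cos_of_nonneg_of_le_pi hyI.1.le (by linarith [hxI.2, Real.pi_pos]) hyx
    have hxy := hpair x y hx hy hyx.ne'
    have hcx : 0 < Real.cos x := Real.cos_pos_of_mem_Ioo ⟨by linarith [hxI.1, Real.pi_pos], hxI.2⟩
    -- Two different angles force λ > 0, so the quotient 1/(bλ) is not the default value of division
    -- by zero.
    have hlb : 0 < lam * b := by
      by_contra! h
      have := mul_nonpos_of_nonpos_of_nonneg h (by linarith : 0 ≤ Real.cos x + Real.cos y)
      linarith
    -- A second chord of angle y would give 2λb cos y ≤ 1, but cos y > cos x and λb(cos x + cos y) =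
    -- 1 give 2λb cos y > 1.
    have hy1 : anglesB a b E y = 1 := by
      obtain ⟨S, hS, hSE⟩ := anglesB_ne_zero_iff.1 hy
      have : {S | IsChord a b y S ∧ S ⊆ frontier E} = {S} := by
        refine Subset.antisymm (fun S' hS' => ?_) (by rintro _ rfl; exact ⟨hS, hSE⟩)
        by_contra hSS
        have := (chord_pair ha hab hE hEc hopt hS'.1 hS'.2 hS hSE fun h => hSS h.2).1 rfl
        have := mul_lt_mul_of_pos_left hcos hlb
        linarith
      rw [anglesB, this, encard_singleton]
    refine ⟨x, hxI, y, hyI, n, hn, Or.inr ⟨?_, hyx, ?_⟩⟩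
    · funext z
      rw [Pi.add_apply, copies, copies]
      rcases eq_or_ne z x with rfl | hzx
      · rw [Pi.single_eq_same, Pi.single_eq_of_ne hyx.ne', add_zero, hxn]
      rcases eq_or_ne z y with rfl | hzy
      · rw [Pi.single_eq_same, Pi.single_eq_of_ne hzx, zero_add, hy1, Nat.cast_one]
      rw [Pi.single_eq_of_ne hzx, Pi.single_eq_of_ne hzy, add_zero]
      by_contra hz
      -- Pairing a third angle z with x yields cos z = cos y.
      have h1 := hpair x z hx hz hzx.symm
      have hzI := hIoo z hz
      refine hzy (Real.injOn_cos ⟨hzI.1.le, by linarith [hzI.2, hzI.1]⟩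
        ⟨hyI.1.le, by linarith [hyI.2, hyI.1]⟩ ?_)
      have := mul_left_cancel₀ hlb.ne' (h1.trans hxy.symm)
      linarith
    · rw [eq_div_iff (by rw [mul_comm]; exact hlb.ne')]
      linear_combination hxy

end

end AnnulusProblem

end

theorem theorem2p6 (a b lam : ℝ) (ha : 0 < a) (hab : a < b) (hlam : 0 ≤ lam)
    (Ω : Set ℂ) (hopt : AnnulusProblem.IsOptimal a b lam Ω) (hK : Ω ∈ AnnulusProblem.classK a b) :
    (lam ≠ 2 / a → ∃ θ ∈ Set.Ioo 0 (Real.pi / 2),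
      AnnulusProblem.anglesA a b Ω ≠ 0 →
        AnnulusProblem.anglesA a b Ω = AnnulusProblem.copies 1 θ) ∧
    (∃ x ∈ Set.Ioo 0 (Real.pi / 2), ∃ y ∈ Set.Ioo 0 (Real.pi / 2),
      AnnulusProblem.anglesB a b Ω ≠ 0 →
        ∃ n : ℕ, 1 ≤ n ∧
          (AnnulusProblem.anglesB a b Ω = AnnulusProblem.copies n x ∨
            (AnnulusProblem.anglesB a b Ω =
                AnnulusProblem.copies n x + AnnulusProblem.copies 1 y ∧
              y < x ∧ Real.cos x + Real.cos y = 1 / (b * lam)))) := by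
  have hE := AnnulusProblem.closure_mem_classC hopt.1
  have hfr := AnnulusProblem.frontier_closure_eq ha hopt.1
  have hmin : ∀ K ∈ AnnulusProblem.classC a b,
      AnnulusProblem.J lam (closure Ω) ≤ AnnulusProblem.J lam K := by
    rw [AnnulusProblem.J_closure ha lam hopt.1]
    exact hopt.2
  have hA : AnnulusProblem.anglesA a b Ω = AnnulusProblem.anglesA a b (closure Ω) := by
    unfold AnnulusProblem.anglesA
    rw [hfr]
  have hB : AnnulusProblem.anglesB a b Ω = AnnulusProblem.anglesB a b (closure Ω) := by
    unfold AnnulusProblem.anglesB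
    rw [hfr]
  have hπ := Real.pi_pos
  have hπ4 : Real.pi / 4 ∈ Set.Ioo 0 (Real.pi / 2) := ⟨by linarith, by linarith⟩
  rw [hA, hB]
  constructor
  · intro hne
    by_cases h : AnnulusProblem.anglesA a b (closure Ω) = 0
    -- With no element present the angle is arbitrary.
    · exact ⟨Real.pi / 4, hπ4, fun h' => absurd h h'⟩
    · obtain ⟨θ, hθ⟩ := Function.ne_iff.1 h
      obtain ⟨S, hS, hSE⟩ := Set.encard_ne_zero.1 hθ
      obtain ⟨hθ', -⟩ := hS.exists_eq ha
      exact ⟨θ, ⟨hθ'.1, hθ'.2.1⟩, fun _ =>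
        AnnulusProblem.anglesA_eq_copies ha hab hE isClosed_closure hmin hne hS hSE⟩
  · by_cases h : AnnulusProblem.anglesB a b (closure Ω) = 0
    · exact ⟨Real.pi / 4, hπ4, Real.pi / 4, hπ4, fun h' => absurd h h'⟩
    · obtain ⟨x, hx, y, hy, hn⟩ :=
        AnnulusProblem.anglesB_eq_copies ha hab hE isClosed_closure hmin h
      exact ⟨x, hx, y, hy, fun _ => hn⟩
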